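/- Let $\mathcal H$ be a complex Hilbert space, $n\ge 1$, and let $X=(X_1,\dots,X_n)$ be a tuple of commuting contractions on $\mathcal H$, each of which is pure (a contraction $T$ is pure if $T^{*k}\to 0$ strongly as $k\to\infty$). Write $\hat X_n=(X_1,\dots,X_{n-1})$, $C_A(Y)=AYA^*$, and $$\mathbb S^{-1}(\hat X_n,\hat X_n^*)=\prod_{j=1}^{n-1}(I-C_{X_j})(I_{\mathcal H})=\sum_{F\subseteq\{1,\dots,n-1\}}(-1)^{|F|}X_FX_F^*,\qquad X_F=\prod_{j\in F}X_j .$$ Assume that $X$ belongs to $\mathcal P_n(\mathcal H)$, that is, $\mathbb S^{-1}(\hat X_n,\hat X_n^*)\ge 0$ and there are positive operators $G_1,\dots,G_{n-1}$ on $\mathcal H$ such that $$I-X_nX_n^*=G_1+\dots+G_{n-1}\quad\text{and}\quad S_X(G_i):=\prod_{1\le j\le n-1,\ j\ne i}(I-C_{X_j})(G_i)\ge 0\quad(1\le i\le n-1).$$ Assume moreover that $X$ has finite rank, that is, the defect space $\mathcal D_{\hat X_n}=\overline{\operatorname{ran}}\,\mathbb S^{-1}(\hat X_n,\hat X_n^*)^{1/2}$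 is finite dimensional and, for some choice of such $G_1,\dots,G_{n-1}$, the spaces $\mathcal F_i=\overline{\operatorname{ran}}\,S_X(G_i)^{1/2}$ $(1\le i\le n-1)$ are finite dimensional. Put $\mathcal D=\mathcal D_{\hat X_n}$ and let $H^2_{\mathcal D}(\mathbb D^{n-1})$ be the $\mathcal D$-valued Hardy space of the polydisc: the functions $f(z)=\sum_{k\in\mathbb N^{n-1}}a_kz^k$ with $a_k\in\mathcal D$ and $\|f\|^2=\sum_k\|a_k\|^2<\infty$ (for $n=1$, $\mathbb D^0$ is one point). Then there is a function $\Phi$ in the Schur–Agler class $\mathcal{SA}_{n-1}(\mathcal D,\mathcal D)$, that is, a bounded analytic function $\Phi:\mathbb D^{n-1}\to\mathcal B(\mathcal D)$ of the form $$\Phi(z)=A+BE(z)(I-DE(z))^{-1}C,\qquad E(z)=\bigoplus_{i=1}^{n-1}z_iI_{\mathcal K_i},$$ for some Hilbert spaces $\mathcal K_1,\dots,\mathcal K_{n-1}$ and some unitary $\begin{bmatrix}A&B\\C&D\end{bmatrix}$ on $\mathcal D\oplus\bigoplus_{i=1}^{n-1}\mathcal K_i$, such that the multiplication operators $M_{z_1},\dots,M_{z_{n-1}},M_\Phi$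 are bounded on $H^2_{\mathcal D}(\mathbb D^{n-1})$, commute pairwise, and are pure isometries, i.e. isometries that are pure contractions (in particular $\Phi$ is a pure inner multiplier), and $X$ dilates to $(M_{z_1},\dots,M_{z_{n-1}},M_\Phi)$: there is an isometry $\Pi:\mathcal H\to H^2_{\mathcal D}(\mathbb D^{n-1})$ with $$\Pi X_i^*=M_{z_i}^*\Pi\quad(1\le i\le n-1),\qquad \Pi X_n^*=M_\Phi^*\Pi .$$ -/

import Mathlib

open Filter Topology

noncomputable section

namespace PolydiscDilation

universe u

/-! ### Pure contractions and pure isometries, tuples of contractions -/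

section Operators

variable {H : Type u} [NormedAddCommGroup H] [InnerProductSpace ℂ H] [CompleteSpace H]

/-- `T` is a contraction and `T⋆ ^ k → 0` in the strong operator topology. -/
def IsPureContraction (T : H →L[ℂ] H) : Prop :=
  ‖T‖ ≤ 1 ∧ ∀ h : H, Tendsto (fun k : ℕ => (T.adjoint ^ k) h) atTop (𝓝 0)

/-- A pure isometry: an isometry which is a pure contraction. -/
def IsPureIsometry (V : H →L[ℂ] H) : Prop :=
  (∀ h : H, ‖V h‖ = ‖h‖) ∧ IsPureContraction V

/-- Tuples of commuting contractions. -/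
def IsCommutingContractions {n : ℕ} (X : Fin n → H →L[ℂ] H) : Prop :=
  (∀ i, ‖X i‖ ≤ 1) ∧ ∀ i j, Commute (X i) (X j)

/-- The conjugation map `C_A : Y ↦ A Y A⋆`. -/
def conjMap (A : H →L[ℂ] H) : (H →L[ℂ] H) →ₗ[ℂ] (H →L[ℂ] H) where
  toFun Y := A * Y * A.adjoint
  map_add' Y Z := by rw [mul_add, add_mul]
  map_smul' c Y := by simp

/-- `𝕊⁻¹(X, X⋆) = ∏ j, (1 - C_{X j}) (1)`; for commuting `X` this is
`∑ F, (-1) ^ |F| X_F X_F⋆` over the subsets `F` of the index set, i.e. the inverse Szegő kernel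
`∏ j, (1 - z j * conj (w j))` of the polydisc evaluated at `(X, X⋆)`. -/
def szegoInv {n : ℕ} (X : Fin n → H →L[ℂ] H) : H →L[ℂ] H :=
  (List.ofFn fun j => (1 : Module.End ℂ (H →L[ℂ] H)) - conjMap (X j)).prod 1

/-- The class `𝕊_n(H)` of commuting contractions with `𝕊⁻¹(X, X⋆) ≥ 0`. -/
def IsSzegoPositive {n : ℕ} (X : Fin n → H →L[ℂ] H) : Prop :=
  IsCommutingContractions X ∧ (szegoInv X).IsPositive

/-- The tuple `X̂` obtained by deleting the last entry of `X`. -/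
def dropLast {n : ℕ} (X : Fin (n + 1) → H →L[ℂ] H) : Fin n → H →L[ℂ] H :=
  fun i => X i.castSucc

/-- The closure of the range of `S ^ (1/2)`, for a positive operator `S`. -/
abbrev sqrtRange (S : H →L[ℂ] H) : Submodule ℂ H :=
  (CFC.sqrt S).range.topologicalClosure

/-- The defect space of `X̂`, the closure of the range of `𝕊⁻¹(X̂, X̂⋆) ^ (1/2)`. -/
abbrev defectSpace {n : ℕ} (X : Fin (n + 1) → H →L[ℂ] H) : Submodule ℂ H :=
  sqrtRange (szegoInv (dropLast X))

/-- `S_X(G i) = ∏_{j ≠ i} (1 - C_{X j}) (G i)`, where `j` runs over all indices of `X` except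
`i` and the last one. -/
def partialSzego {n : ℕ} (X : Fin (n + 1) → H →L[ℂ] H) (G : Fin n → H →L[ℂ] H) (i : Fin n) :
    H →L[ℂ] H :=
  (List.ofFn fun j : Fin n =>
    if j = i then (1 : Module.End ℂ (H →L[ℂ] H)) else 1 - conjMap (X j.castSucc)).prod (G i)

/-- `G` is a positive decomposition of `1 - X_n X_n⋆` as in the definition of the class `P_n`. -/
def IsDecomposition {n : ℕ} (X : Fin (n + 1) → H →L[ℂ] H) (G : Fin n → H →L[ℂ] H) : Prop :=
  (∀ i, (G i).IsPositive) ∧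
  1 - X (Fin.last n) * (X (Fin.last n)).adjoint = ∑ i, G i ∧
  ∀ i, (partialSzego X G i).IsPositive

/-- The class `P_{n+1}(H)` of `(n+1)`-tuples. -/
def MemP {n : ℕ} (X : Fin (n + 1) → H →L[ℂ] H) : Prop :=
  IsCommutingContractions X ∧ IsSzegoPositive (dropLast X) ∧ ∃ G, IsDecomposition X G

/-- Finite rank of a tuple in `P_{n+1}(H)`: the defect space of `X̂` is finite dimensional, and so
are the spaces `F_i`, the closures of the ranges of `S_X(G i) ^ (1/2)`, for some admissible `G`. -/
def IsFiniteRank {n : ℕ} (X : Fin (n + 1) → H →L[ℂ] H) : Prop :=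
  FiniteDimensional ℂ (defectSpace X) ∧
  ∃ G, IsDecomposition X G ∧ ∀ i, FiniteDimensional ℂ (sqrtRange (partialSzego X G i))

/-- `X` on `H` dilates to `V` on `K`: there is an isometry `J : H → K` with
`J (X i)⋆ = (V i)⋆ J` for all `i`. -/
def DilatesTo {K : Type u} [NormedAddCommGroup K] [InnerProductSpace ℂ K] [CompleteSpace K]
    {n : ℕ} (X : Fin n → H →L[ℂ] H) (V : Fin n → K →L[ℂ] K) : Prop :=
  ∃ J : H →ₗᵢ[ℂ] K, ∀ i, ∀ h : H, J ((X i).adjoint h) = (V i).adjoint (J h)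

end Operators

/-! ### The vector-valued Hardy space of the polydisc -/

section Hardy

variable (E : Type u) [NormedAddCommGroup E] [InnerProductSpace ℂ E]

/-- The open unit polydisc in `ℂ^n`. -/
def polydisc (n : ℕ) : Set (Fin n → ℂ) := {z | ∀ i, ‖z i‖ < 1}

/-- The `E`-valued Hardy space of the polydisc: the functions `f z = ∑ k, z ^ k • a k` with
`∑ k, ‖a k‖ ^ 2 < ∞`, normed by the `ℓ²` norm of `a`. An element is given by its family
`a` of Taylor coefficients. -/
abbrev Hardy (n : ℕ) : Type u := lp (fun _ : Fin n → ℕ => E) 2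

variable {E}

/-- The value at `z` of the analytic function `f`. -/
def Hardy.eval {n : ℕ} (f : Hardy E n) (z : Fin n → ℂ) : E :=
  ∑' k : Fin n → ℕ, (∏ i, z i ^ k i) • f k

/-- The bounded operator `T` is the multiplication operator `M_Φ`: `(T f)(z) = Φ(z) f(z)`. -/
def IsMultiplication {n : ℕ} (Φ : (Fin n → ℂ) → E →L[ℂ] E) (T : Hardy E n →L[ℂ] Hardy E n) :
    Prop :=
  ∀ f : Hardy E n, ∀ z ∈ polydisc n, Hardy.eval (T f) z = Φ z (Hardy.eval f z)

end Hardy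

/-! ### The Schur–Agler class -/

section SchurAgler

variable {E : Type u} [NormedAddCommGroup E] [InnerProductSpace ℂ E]
variable {n : ℕ} {K : Fin n → Type u} [∀ i, NormedAddCommGroup (K i)]
  [∀ i, InnerProductSpace ℂ (K i)]

/-- The operator `E(z) = ⨁ i, z i • 1` on the Hilbert sum of the `K i`. -/
def diagMul (K : Fin n → Type u) [∀ i, NormedAddCommGroup (K i)]
    [∀ i, InnerProductSpace ℂ (K i)] (z : Fin n → ℂ) : PiLp 2 K →L[ℂ] PiLp 2 K :=
  (PiLp.continuousLinearEquiv 2 ℂ K).symm.toContinuousLinearMap ∘L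
    ContinuousLinearMap.pi fun i => z i • PiLp.proj 2 K i

/-- The embedding of `E` in the Hilbert sum of `E` and `F`. -/
def inlL (E F : Type u) [NormedAddCommGroup E] [InnerProductSpace ℂ E] [NormedAddCommGroup F]
    [InnerProductSpace ℂ F] : E →L[ℂ] WithLp 2 (E × F) :=
  (WithLp.prodContinuousLinearEquiv 2 ℂ E F).symm.toContinuousLinearMap ∘L
    ContinuousLinearMap.inl ℂ E F

/-- The embedding of `F` in the Hilbert sum of `E` and `F`. -/
def inrL (E F : Type u) [NormedAddCommGroup E] [InnerProductSpace ℂ E] [NormedAddCommGroup F]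
    [InnerProductSpace ℂ F] : F →L[ℂ] WithLp 2 (E × F) :=
  (WithLp.prodContinuousLinearEquiv 2 ℂ E F).symm.toContinuousLinearMap ∘L
    ContinuousLinearMap.inr ℂ E F

/-- The transfer function `A + B E(z) (1 - D E(z))⁻¹ C` of the operator `U = [A B; C D]` on
`E ⊕ (⨁ i, K i)`. -/
def transferFunction (U : WithLp 2 (E × PiLp 2 K) →L[ℂ] WithLp 2 (E × PiLp 2 K))
    (z : Fin n → ℂ) : E →L[ℂ] E :=
  let A : E →L[ℂ] E := WithLp.fstL 2 ℂ E (PiLp 2 K) ∘L U ∘L inlL E (PiLp 2 K)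
  let B : PiLp 2 K →L[ℂ] E := WithLp.fstL 2 ℂ E (PiLp 2 K) ∘L U ∘L inrL E (PiLp 2 K)
  let C : E →L[ℂ] PiLp 2 K := WithLp.sndL 2 ℂ E (PiLp 2 K) ∘L U ∘L inlL E (PiLp 2 K)
  let D : PiLp 2 K →L[ℂ] PiLp 2 K := WithLp.sndL 2 ℂ E (PiLp 2 K) ∘L U ∘L inrL E (PiLp 2 K)
  A + B ∘L diagMul K z ∘L Ring.inverse (1 - D ∘L diagMul K z) ∘L C

/-- The Schur–Agler class `SA_n(E, E)`: bounded analytic functions on the polydisc that are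
transfer functions of a unitary operator on `E ⊕ (⨁ i, K i)` for some Hilbert spaces `K i`. -/
def IsSchurAgler (Φ : (Fin n → ℂ) → E →L[ℂ] E) : Prop :=
  DifferentiableOn ℂ Φ (polydisc n) ∧ (∃ M : ℝ, ∀ z ∈ polydisc n, ‖Φ z‖ ≤ M) ∧
  ∃ (K : Fin n → Type u) (_ : ∀ i, NormedAddCommGroup (K i))
    (_ : ∀ i, InnerProductSpace ℂ (K i)) (_ : ∀ i, CompleteSpace (K i))
    (U : WithLp 2 (E × PiLp 2 K) ≃ₗᵢ[ℂ] WithLp 2 (E × PiLp 2 K)),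
    ∀ z ∈ polydisc n, Φ z = transferFunction U.toContinuousLinearEquiv.toContinuousLinearMap z

end SchurAgler

end PolydiscDilation

end

noncomputable section

namespace PolydiscDilation

universe u

/-! ### Ordered products of commuting families -/

section Monoid

variable {M : Type*} [Monoid M] {n : ℕ}

/-! Write `T i = X_i⋆`, `R = X_n⋆`, and let `D`, `F i` be the square roots of `𝕊⁻¹` and `S_X(G i)`,
with values in the finite-dimensional spaces `E` and `K i`. Applying `∏ (1 - C_{X_j})` to `1 - X_n
X_n⋆ = ∑ G i` shows that `(D R h, (F i h)_i)` and `(D h, (F i (T i h))_i)` have equal norms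
(`norm_energy`). By finite rank, the isometry sending the first vector to the second extends to a
unitary `U = [A B; C D]` of the whole space (`exists_colligation`), whose transfer function is `Φ`.

`Φ` is inner. Expand `Φ x` in homogeneous terms; unitarity bounds the defect from isometry by the
state terms `(D E(z))^m C x`. These tend to zero: the Hilbert–Schmidt norm of `(D E(z))^m` on
constants decreases in `m`, and its decrement is exactly that of `(D E(z))^m C`
(`sum_norm_sq_stateOp`, `tendsto_stateTerm`).

The isometry is `Π h = ∑ z^k D T^k h`; it is isometric because purity lets `∏ (1 - C_{X_j})` be
inverted by a sum over multi-indices (`hasSum_szegoMap`). Iterating the relation defining `U` gives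
`⟨D R h, x⟩ = ⟨Π h, Φ x⟩` up to an error pairing a state term with the degree `p + 1` part of `∑ z^k
(F i T^k h)_i`. That part need not be square summable over `p`, but each has norm at most `‖h‖`
(`sum_ofDegree_le`), so the error vanishes and `Π R = M_Φ⋆ Π`.

`M_Φ` is pure as soon as `A = Φ(0)` has powers tending to zero, since `M_Φ⋆` is triangular on
monomials with diagonal `A⋆` (`isPureIsometry_innerMult`). A unimodular eigenvector `x` of `A`
satisfies `C x = 0`, so `Φ x` is constant and `⟨D R h, x⟩ = c ⟨D h, x⟩`; purity of `X_n` then forces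
`x = 0` (`tendsto_blockA_pow`). -/

theorem prod_ofFn_mul : ∀ {n : ℕ} (f g : Fin n → M) (_ : ∀ i j, Commute (g i) (f j)),
    (List.ofFn fun i => f i * g i).prod = (List.ofFn f).prod * (List.ofFn g).prod
  | 0, f, g, _ => by simp
  | n + 1, f, g, h => by
    have hc : Commute (g 0) (List.ofFn fun i : Fin n => f i.succ).prod := by
      apply Commute.list_prod_right
      intro x hx
      obtain ⟨j, rfl⟩ := (List.mem_ofFn' _ _).1 hx
      exact h 0 j.succ
    simp only [List.ofFn_succ, List.prod_cons]
    rw [prod_ofFn_mul (fun i => f i.succ) (fun i => g i.succ) fun i j => h _ _]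
    rw [mul_assoc, mul_assoc, ← mul_assoc (g 0), hc.eq, mul_assoc]

theorem prod_ofFn_one (n : ℕ) : (List.ofFn fun _ : Fin n => (1 : M)).prod = 1 := by
  induction n with
  | zero => simp
  | succ n ih => simp [List.ofFn_succ]

theorem prod_ofFn_mulSingle : ∀ {n : ℕ} (i : Fin n) (x : M),
    (List.ofFn (Pi.mulSingle (M := fun _ => M) i x)).prod = x
  | n + 1, i, x => by
    rw [List.ofFn_succ, List.prod_cons]
    refine Fin.cases ?_ (fun i => ?_) i
    · have : (fun j : Fin n => (Pi.mulSingle (M := fun _ => M) (0 : Fin (n + 1)) x) j.succ) =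
          fun _ => 1 := by
        funext j
        simp [Pi.mulSingle, Function.update]
      rw [this, prod_ofFn_one]
      simp
    · have : (fun j : Fin n => (Pi.mulSingle (M := fun _ => M) i.succ x) j.succ) =
          Pi.mulSingle i x := by
        funext j
        simp [Pi.mulSingle, Function.update]
      rw [this, prod_ofFn_mulSingle]
      simp [Pi.mulSingle, Function.update, (Fin.succ_ne_zero i).symm]

/-- The family is the pointwise product of `Pi.mulSingle i (a i)` and `Function.update a i 1`, so
`prod_ofFn_mul` applies. -/
theorem prod_ofFn_eq_mul_update (a : Fin n → M) (h : ∀ i j, Commute (a i) (a j)) (i : Fin n) :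
    (List.ofFn a).prod = a i * (List.ofFn (Function.update a i 1)).prod := by
  conv_rhs => rw [← prod_ofFn_mulSingle (n := n) i (a i)]
  rw [← prod_ofFn_mul]
  · congr 2
    funext j
    by_cases hj : j = i
    · subst hj; simp
    · simp [hj]
  · intro j l
    by_cases hj : j = i
    · subst hj; simp
    · by_cases hl : l = i
      · subst hl; simpa [hj] using h _ _
      · simp [hl]

/-- The ordered product `∏ i, Y i ^ k i`. -/
def multiPow (Y : Fin n → M) (k : Fin n → ℕ) : M := (List.ofFn fun i => Y i ^ k i).prod

theorem multiPow_zero (Y : Fin n → M) : multiPow Y 0 = 1 := by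
  simp [multiPow]

theorem multiPow_add {Y : Fin n → M} (h : ∀ i j, Commute (Y i) (Y j)) (k l : Fin n → ℕ) :
    multiPow Y (k + l) = multiPow Y k * multiPow Y l := by
  rw [multiPow, multiPow, multiPow, ← prod_ofFn_mul]
  · simp [pow_add]
  · exact fun i j => (h i j).pow_pow _ _

theorem multiPow_single (Y : Fin n → M) (i : Fin n) : multiPow Y (Pi.single i 1) = Y i := by
  conv_rhs => rw [← prod_ofFn_mulSingle (n := n) i (Y i)]
  unfold multiPow
  congr 2
  funext j
  by_cases hj : j = i
  · subst hj; simp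
  · simp [hj]

theorem commute_multiPow {Y : Fin n → M} {y : M} (h : ∀ i, Commute y (Y i)) (k : Fin n → ℕ) :
    Commute y (multiPow Y k) := by
  apply Commute.list_prod_right
  intro x hx
  obtain ⟨j, rfl⟩ := (List.mem_ofFn' _ _).1 hx
  exact (h j).pow_right _

end Monoid

theorem multiPow_update_zero {M : Type*} [MonoidWithZero M] {n : ℕ} (Y : Fin n → M) (i : Fin n)
    (k : Fin n → ℕ) :
    multiPow (Function.update Y i 0) k = if k i = 0 then multiPow Y k else 0 := by
  split_ifs with h
  · unfold multiPow
    congr 2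
    funext j
    by_cases hj : j = i
    · subst hj; simp [h]
    · simp [hj]
  · apply List.prod_eq_zero
    rw [List.mem_ofFn']
    exact ⟨i, by simp [h]⟩

/-! ### Summation of `∏ j, (1 - C_{Y j})` -/

section Szego

variable {H : Type u} [NormedAddCommGroup H] [InnerProductSpace ℂ H] [CompleteSpace H] {n : ℕ}

/-- The map `∏ j, (1 - C_{Y j})`. -/
def szegoMap (Y : Fin n → H →L[ℂ] H) : Module.End ℂ (H →L[ℂ] H) :=
  (List.ofFn fun j => (1 : Module.End ℂ (H →L[ℂ] H)) - conjMap (Y j)).prod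

theorem szegoInv_eq (Y : Fin n → H →L[ℂ] H) : szegoInv Y = szegoMap Y 1 := rfl

theorem conjMap_apply (A Y : H →L[ℂ] H) : conjMap A Y = A * Y * A.adjoint := rfl

theorem conjMap_zero : conjMap (0 : H →L[ℂ] H) = 0 := by
  ext1 Y
  simp [conjMap_apply]

theorem conjMap_commute {A B : H →L[ℂ] H} (h : Commute A B) :
    Commute (conjMap A) (conjMap B) := by
  have h' : A.adjoint * B.adjoint = B.adjoint * A.adjoint := by
    have := congrArg ContinuousLinearMap.adjoint h.eq
    rw [ContinuousLinearMap.mul_def, ContinuousLinearMap.mul_def,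
      ContinuousLinearMap.adjoint_comp, ContinuousLinearMap.adjoint_comp] at this
    exact this.symm
  refine LinearMap.ext fun Y => ?_
  simp only [Module.End.mul_apply, conjMap_apply]
  calc A * (B * Y * B.adjoint) * A.adjoint = (A * B) * Y * (B.adjoint * A.adjoint) := by
        simp only [mul_assoc]
    _ = (B * A) * Y * (A.adjoint * B.adjoint) := by rw [h.eq, h']
    _ = _ := by simp only [mul_assoc]

theorem one_sub_conjMap_commute {A B : H →L[ℂ] H} (h : Commute A B) :
    Commute (1 - conjMap A) (1 - conjMap B) :=
  ((Commute.one_left _).sub_left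
    ((Commute.one_right _).sub_right (conjMap_commute h)))

/-- Since `1 - C_0 = 1`, zeroing an entry deletes its factor. This makes `partialSzego` an instance
of `szegoMap`, so one summation lemma serves both. -/
theorem szegoMap_update_zero (Y : Fin n → H →L[ℂ] H) (i : Fin n) :
    szegoMap (Function.update Y i 0) =
      (List.ofFn (Function.update
        (fun j => (1 : Module.End ℂ (H →L[ℂ] H)) - conjMap (Y j)) i 1)).prod := by
  unfold szegoMap
  congr 2
  funext j
  by_cases hj : j = i
  · subst hj; simp [conjMap_zero]
  · simp [hj]

theorem partialSzego_eq (X : Fin (n + 1) → H →L[ℂ] H) (G : Fin n → H →L[ℂ] H) (i : Fin n) :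
    partialSzego X G i = szegoMap (Function.update (dropLast X) i 0) (G i) := by
  unfold partialSzego szegoMap
  congr 3
  funext j
  by_cases hj : j = i
  · subst hj; simp [conjMap_zero]
  · simp [hj, dropLast]

theorem szegoMap_eq_update (Y : Fin n → H →L[ℂ] H) (h : ∀ i j, Commute (Y i) (Y j)) (i : Fin n) :
    szegoMap Y = (1 - conjMap (Y i)) * szegoMap (Function.update Y i 0) := by
  rw [szegoMap_update_zero]
  exact prod_ofFn_eq_mul_update _ (fun i j => one_sub_conjMap_commute (h i j)) i

theorem conjMap_commute_szegoMap (Y : Fin n → H →L[ℂ] H) {A : H →L[ℂ] H}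
    (h : ∀ i, Commute A (Y i)) : Commute (conjMap A) (szegoMap Y) := by
  apply Commute.list_prod_right
  intro x hx
  obtain ⟨j, rfl⟩ := (List.mem_ofFn' _ _).1 hx
  exact (Commute.one_right _).sub_right (conjMap_commute (h j))

theorem reApplyInnerSelf_conjMap (A Q : H →L[ℂ] H) (h : H) :
    (conjMap A Q).reApplyInnerSelf h = Q.reApplyInnerSelf (A.adjoint h) := by
  simp only [ContinuousLinearMap.reApplyInnerSelf_apply, conjMap_apply,
    mul_apply_eq_comp, ContinuousLinearMap.adjoint_inner_right]

/-- The partial sums telescope to the form of `Q` at `h` minus its value at `A⋆ ^ N h`, which tends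
to zero by stability. -/
theorem hasSum_one_sub_conjMap {A Q : H →L[ℂ] H}
    (hA : ∀ h : H, Tendsto (fun k : ℕ => (A.adjoint ^ k) h) atTop (𝓝 0))
    (hS : ∀ h, 0 ≤ ((1 - conjMap A) Q).reApplyInnerSelf h) (h : H) :
    HasSum (fun k : ℕ => ((1 - conjMap A) Q).reApplyInnerSelf ((A.adjoint ^ k) h))
      (Q.reApplyInnerSelf h) := by
  rw [hasSum_iff_tendsto_nat_of_nonneg fun _ => hS _]
  have hstep : ∀ k : ℕ, ((1 - conjMap A) Q).reApplyInnerSelf ((A.adjoint ^ k) h) =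
      Q.reApplyInnerSelf ((A.adjoint ^ k) h) - Q.reApplyInnerSelf ((A.adjoint ^ (k + 1)) h) := by
    intro k
    have : ((1 - conjMap A) Q) = Q - conjMap A Q := rfl
    rw [this, pow_succ', mul_apply_eq_comp, ← reApplyInnerSelf_conjMap]
    simp [ContinuousLinearMap.reApplyInnerSelf_apply, inner_sub_left]
  simp only [hstep]
  have hcont : Continuous Q.reApplyInnerSelf := Q.reApplyInnerSelf_continuous
  have hlim := (hcont.tendsto 0).comp (hA h)
  have h0 : Q.reApplyInnerSelf (0 : H) = 0 := by
    simp [ContinuousLinearMap.reApplyInnerSelf_apply]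
  rw [h0] at hlim
  simp only [Finset.sum_range_sub']
  simpa using tendsto_const_nhds.sub hlim

theorem hasSum_prod_of_nonneg {α β : Type*} {f : α × β → ℝ} {g : α → ℝ} {a : ℝ}
    (hf : ∀ p, 0 ≤ f p) (h₁ : ∀ x, HasSum (fun y => f (x, y)) (g x)) (h₂ : HasSum g a) :
    HasSum f a := by
  have hs : Summable f := by
    rw [summable_prod_of_nonneg hf]
    refine ⟨fun x => (h₁ x).summable, ?_⟩
    simpa only [(h₁ _).tsum_eq] using h₂.summable
  have := hs.hasSum.prod_fiberwise h₁
  rw [h₂.unique this]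
  exact hs.hasSum

/-- Inverts `∏ (1 - C_{Y j})` at the level of quadratic forms, one variable at a time. -/
theorem hasSum_szegoMap : ∀ {n : ℕ} (Y : Fin n → H →L[ℂ] H)
    (_ : ∀ i, ∀ h : H, Tendsto (fun k : ℕ => ((Y i).adjoint ^ k) h) atTop (𝓝 0))
    (Q : H →L[ℂ] H) (_ : ∀ h, 0 ≤ (szegoMap Y Q).reApplyInnerSelf h) (h : H),
    HasSum (fun k : Fin n → ℕ => (szegoMap Y Q).reApplyInnerSelf
      (multiPow (fun i => (Y i).adjoint) k h)) (Q.reApplyInnerSelf h)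
  | 0, Y, _, Q, _, h => by
    have : (fun k : Fin 0 → ℕ => (szegoMap Y Q).reApplyInnerSelf
        (multiPow (fun i => (Y i).adjoint) k h)) = fun _ => Q.reApplyInnerSelf h := by
      funext k
      simp [szegoMap, multiPow]
    rw [this]
    exact hasSum_unique _
  | n + 1, Y, hY, Q, hS, h => by
    have hsz : szegoMap Y Q = (1 - conjMap (Y 0)) (szegoMap (fun i : Fin n => Y i.succ) Q) := by
      simp [szegoMap, List.ofFn_succ]
    set R := szegoMap (fun i : Fin n => Y i.succ) Q with hR
    have h1 : ∀ h, HasSum (fun k : ℕ => (szegoMap Y Q).reApplyInnerSelf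
        (((Y 0).adjoint ^ k) h)) (R.reApplyInnerSelf h) := by
      intro h
      rw [hsz] at hS ⊢
      exact hasSum_one_sub_conjMap (hY 0) hS h
    -- Positivity passes to the product with fewer factors because its form is a sum of nonnegative
    -- terms; this feeds the recursion.
    have hRpos : ∀ h, 0 ≤ R.reApplyInnerSelf h := fun h => (h1 h).nonneg fun _ => hS _
    have h2 := hasSum_szegoMap (fun i : Fin n => Y i.succ) (fun i => hY i.succ) Q hRpos h
    rw [← (Fin.consEquiv fun _ => ℕ).hasSum_iff, ← (Equiv.prodComm _ _).hasSum_iff]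
    refine hasSum_prod_of_nonneg (fun _ => hS _) (fun k' => ?_) h2
    simpa [multiPow, List.ofFn_succ, Fin.consEquiv] using
      h1 (multiPow (fun i : Fin n => (Y i.succ).adjoint) k' h)

end Szego

/-! ### Square roots of positive operators -/

section Sqrt

variable {H : Type u} [NormedAddCommGroup H] [InnerProductSpace ℂ H] [CompleteSpace H]

/-- The operator `S ^ (1/2)`, with values in the closure of its range. -/
def sqrtTo (S : H →L[ℂ] H) : H →L[ℂ] sqrtRange S :=
  (CFC.sqrt S).codRestrict (sqrtRange S) fun x =>
    Submodule.le_topologicalClosure _ (LinearMap.mem_range_self _ x)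

theorem norm_sqrtTo_sq {S : H →L[ℂ] H} (hS : S.IsPositive) (h : H) :
    ‖sqrtTo S h‖ ^ 2 = S.reApplyInnerSelf h := by
  have h0 : 0 ≤ S := (ContinuousLinearMap.nonneg_iff_isPositive S).2 hS
  have h1 : (CFC.sqrt S).adjoint = CFC.sqrt S := (CFC.sqrt_nonneg S).isSelfAdjoint.adjoint_eq
  have h2 : CFC.sqrt S * CFC.sqrt S = S := CFC.sqrt_mul_sqrt_self S h0
  have h3 : ‖sqrtTo S h‖ = ‖CFC.sqrt S h‖ := rfl
  rw [h3, ContinuousLinearMap.reApplyInnerSelf_apply,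
    ContinuousLinearMap.apply_norm_sq_eq_inner_adjoint_left, h1, ← ContinuousLinearMap.mul_def, h2]

theorem eq_zero_of_inner_sqrtTo {S : H →L[ℂ] H} (y : sqrtRange S)
    (hy : ∀ h, inner ℂ (sqrtTo S h) y = 0) : y = 0 := by
  have h1 : (y : H) ∈ ((CFC.sqrt S).range.topologicalClosure)ᗮ := by
    rw [Submodule.orthogonal_closure, Submodule.mem_orthogonal]
    rintro _ ⟨h, rfl⟩
    exact hy h
  have h2 := Submodule.inner_right_of_mem_orthogonal y.2 h1
  exact Subtype.ext (inner_self_eq_zero.1 h2)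

end Sqrt

/-! ### Extending isometries to unitaries in finite dimension -/

/-- Equal norms make `a x ↦ b x` well defined and isometric on the range of `a`. In finite dimension
it extends to an isometry of `V` into itself, which is automatically onto. -/
theorem exists_linearIsometryEquiv_of_norm_eq {H V : Type*} [AddCommGroup H] [Module ℂ H]
    [NormedAddCommGroup V] [InnerProductSpace ℂ V] [FiniteDimensional ℂ V]
    (a b : H →ₗ[ℂ] V) (h : ∀ x, ‖a x‖ = ‖b x‖) : ∃ U : V ≃ₗᵢ[ℂ] V, ∀ x, U (a x) = b x := by
  have hker : LinearMap.ker a ≤ LinearMap.ker b := by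
    intro x hx
    rw [LinearMap.mem_ker] at hx ⊢
    rw [← norm_eq_zero, ← h, hx, norm_zero]
  let L₀ : LinearMap.range a →ₗ[ℂ] V :=
    (LinearMap.ker a).liftQ b hker ∘ₗ a.quotKerEquivRange.symm.toLinearMap
  have hL₀ : ∀ x, L₀ ⟨a x, LinearMap.mem_range_self a x⟩ = b x := by
    intro x
    have : a.quotKerEquivRange.symm ⟨a x, LinearMap.mem_range_self a x⟩ =
        (LinearMap.ker a).mkQ x := by
      rw [LinearEquiv.symm_apply_eq]
      rfl
    simp [L₀, this]
  let L : LinearMap.range a →ₗᵢ[ℂ] V :=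
    ⟨L₀, by
      rintro ⟨_, x, rfl⟩
      rw [hL₀, ← h]
      rfl⟩
  refine ⟨L.extend.toLinearIsometryEquiv rfl, fun x => ?_⟩
  rw [LinearIsometry.toLinearIsometryEquiv_apply]
  exact (L.extend_apply ⟨a x, LinearMap.mem_range_self a x⟩).trans (hL₀ x)

/-! ### The energy identity -/

section Energy

variable {H : Type u} [NormedAddCommGroup H] [InnerProductSpace ℂ H] [CompleteSpace H] {n : ℕ}

theorem reApplyInnerSelf_add (S T : H →L[ℂ] H) (h : H) :
    (S + T).reApplyInnerSelf h = S.reApplyInnerSelf h + T.reApplyInnerSelf h := by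
  simp [ContinuousLinearMap.reApplyInnerSelf_apply, inner_add_left]

theorem reApplyInnerSelf_sum {ι : Type*} (s : Finset ι) (S : ι → H →L[ℂ] H) (h : H) :
    (∑ i ∈ s, S i).reApplyInnerSelf h = ∑ i ∈ s, (S i).reApplyInnerSelf h := by
  simp [ContinuousLinearMap.reApplyInnerSelf_apply, sum_inner]

theorem reApplyInnerSelf_one (h : H) : (1 : H →L[ℂ] H).reApplyInnerSelf h = ‖h‖ ^ 2 :=
  inner_self_eq_norm_sq (𝕜 := ℂ) h

/-- Apply `szegoMap (dropLast X)` to the decomposition `hG`: it commutes with `C_{X_n}`, and on `G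
i` it factors as `(1 - C_{X_i})` after the partial product. Negative terms are moved across so that
every term is a positive operator when the two kernels are. -/
theorem szego_energy (X : Fin (n + 1) → H →L[ℂ] H) (hX : ∀ i j, Commute (X i) (X j))
    (G : Fin n → H →L[ℂ] H)
    (hG : 1 - X (Fin.last n) * (X (Fin.last n)).adjoint = ∑ i, G i) :
    szegoInv (dropLast X) + ∑ i : Fin n, conjMap (X i.castSucc) (partialSzego X G i) =
      conjMap (X (Fin.last n)) (szegoInv (dropLast X)) + ∑ i, partialSzego X G i := by
  have h1 : szegoMap (dropLast X) (conjMap (X (Fin.last n)) 1) =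
      conjMap (X (Fin.last n)) (szegoMap (dropLast X) 1) :=
    (LinearMap.congr_fun
      (conjMap_commute_szegoMap (dropLast X) (A := X (Fin.last n)) fun i => hX _ _).eq 1).symm
  have h2 : ∀ i, szegoMap (dropLast X) (G i) =
      partialSzego X G i - conjMap (X i.castSucc) (partialSzego X G i) := by
    intro i
    rw [szegoMap_eq_update (dropLast X) (fun i j => hX _ _) i, partialSzego_eq]
    rfl
  have h3 : szegoMap (dropLast X) (1 - conjMap (X (Fin.last n)) 1) =
      ∑ i, szegoMap (dropLast X) (G i) := by
    rw [← map_sum, ← hG]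
    simp [conjMap_apply]
  simp only [h2, map_sub, h1, Finset.sum_sub_distrib] at h3
  rw [szegoInv_eq]
  rw [sub_eq_sub_iff_add_eq_add] at h3
  rw [h3, add_comm]

theorem norm_energy {X : Fin (n + 1) → H →L[ℂ] H} (hX : ∀ i j, Commute (X i) (X j))
    {G : Fin n → H →L[ℂ] H} (hG : IsDecomposition X G)
    (hS : (szegoInv (dropLast X)).IsPositive) (h : H) :
    ‖sqrtTo (szegoInv (dropLast X)) h‖ ^ 2 +
        ∑ i : Fin n, ‖sqrtTo (partialSzego X G i) ((X i.castSucc).adjoint h)‖ ^ 2 =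
      ‖sqrtTo (szegoInv (dropLast X)) ((X (Fin.last n)).adjoint h)‖ ^ 2 +
        ∑ i : Fin n, ‖sqrtTo (partialSzego X G i) h‖ ^ 2 := by
  have := congrArg (fun S => S.reApplyInnerSelf h) (szego_energy X hX G hG.2.1)
  simpa only [reApplyInnerSelf_add, reApplyInnerSelf_sum, reApplyInnerSelf_conjMap,
    norm_sqrtTo_sq hS, norm_sqrtTo_sq (hG.2.2 _)] using this

end Energy

/-! ### Sums over multi-indices of a given degree -/

section Degree

variable {n : ℕ}

/-- The multi-indices of total degree `p`. -/
abbrev ofDegree (n p : ℕ) : Finset (Fin n → ℕ) := Finset.piAntidiag Finset.univ p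

theorem mem_ofDegree {p : ℕ} {k : Fin n → ℕ} : k ∈ ofDegree n p ↔ ∑ i, k i = p := by
  simp [ofDegree]

theorem sum_add_single (k : Fin n → ℕ) (i : Fin n) :
    ∑ j, (k + Pi.single i 1 : Fin n → ℕ) j = ∑ j, k j + 1 := by
  simp [Finset.sum_add_distrib]

/-- Adding `Pi.single i 1` is a bijection from degree `p` onto the indices of degree `p + 1` with
nonzero `i`-th entry. -/
theorem sum_ofDegree_succ {M : Type*} [AddCommMonoid M] (p : ℕ) (i : Fin n)
    (f : (Fin n → ℕ) → M) :
    ∑ k ∈ ofDegree n (p + 1), (if k i = 0 then 0 else f k) =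
      ∑ k ∈ ofDegree n p, f (k + Pi.single i 1) := by
  have : ∑ k ∈ ofDegree n (p + 1), (if k i = 0 then 0 else f k) =
      ∑ k ∈ (ofDegree n (p + 1)).filter (fun k => ¬ k i = 0), f k := by
    rw [Finset.sum_filter]
    exact Finset.sum_congr rfl fun k _ => by split_ifs <;> rfl
  rw [this]
  have hsub : ∀ k : Fin n → ℕ, k i ≠ 0 → k - Pi.single i 1 + Pi.single i 1 = k := by
    intro k hk
    funext j
    by_cases hj : j = i
    · subst hj; simp; omega
    · simp [hj]
  refine Finset.sum_nbij' (fun k => k - Pi.single i 1) (fun k => k + Pi.single i 1) ?_ ?_ ?_ ?_ ?_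
  · intro k hk
    rw [Finset.mem_filter, mem_ofDegree] at hk
    rw [mem_ofDegree]
    have := sum_add_single (k - Pi.single i 1) i
    rw [hsub k hk.2] at this
    omega
  · intro k hk
    rw [mem_ofDegree] at hk
    rw [Finset.mem_filter, mem_ofDegree, sum_add_single]
    simp [hk]
  · intro k hk
    exact hsub k (Finset.mem_filter.1 hk).2
  · intro k _
    simp
  · intro k hk
    rw [hsub k (Finset.mem_filter.1 hk).2]

theorem sum_range_ofDegree_le {f : (Fin n → ℕ) → ℝ} {a : ℝ} (hf : ∀ k, 0 ≤ f k)
    (ha : HasSum f a) (p : ℕ) : ∑ l ∈ Finset.range p, ∑ k ∈ ofDegree n l, f k ≤ a := by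
  rw [← Finset.sum_biUnion]
  · exact sum_le_hasSum _ (fun k _ => hf k) ha
  · intro l _ m _ hlm
    rw [Function.onFun, Finset.disjoint_left]
    intro k hk hk'
    rw [mem_ofDegree] at hk hk'
    exact hlm (hk.symm.trans hk')

end Degree

open scoped Classical

namespace Hardy

/-! ### Operators on the vector-valued Hardy space -/

variable {V W : Type u} [NormedAddCommGroup V] [InnerProductSpace ℂ V]
  [NormedAddCommGroup W] [InnerProductSpace ℂ W] {n : ℕ}

theorem hasSum_norm_sq (f : Hardy V n) : HasSum (fun k => ‖f k‖ ^ 2) (‖f‖ ^ 2) := by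
  have := lp.hasSum_norm (p := 2) (by simp) f
  simpa using this

theorem inner_eq_zero {f g : Hardy V n} (h : ∀ k, f k = 0 ∨ g k = 0) : inner ℂ f g = 0 := by
  rw [lp.inner_eq_tsum]
  convert tsum_zero with k
  rcases h k with h | h <;> simp [h]

/-- The monomial `z ^ k • x`. -/
def monomial (k : Fin n → ℕ) : V →L[ℂ] Hardy V n :=
  lp.singleContinuousLinearMap ℂ (fun _ : Fin n → ℕ => V) 2 k

theorem monomial_apply (k : Fin n → ℕ) (x : V) : monomial k x = lp.single 2 k x := rfl

theorem monomial_coeff (k j : Fin n → ℕ) (x : V) :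
    (monomial k x : Hardy V n) j = if j = k then x else 0 := by
  rw [monomial_apply, lp.single_apply, Pi.single_apply]

theorem inner_monomial_left (k : Fin n → ℕ) (x : V) (f : Hardy V n) :
    inner ℂ (monomial k x) f = inner ℂ x (f k) :=
  lp.inner_single_left k x f

theorem inner_monomial_right (k : Fin n → ℕ) (x : V) (f : Hardy V n) :
    inner ℂ f (monomial k x) = inner ℂ (f k) x :=
  lp.inner_single_right k x f

theorem norm_monomial (k : Fin n → ℕ) (x : V) : ‖(monomial k x : Hardy V n)‖ = ‖x‖ := by
  rw [monomial_apply]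
  exact lp.norm_single (E := fun _ : Fin n → ℕ => V) two_pos k x

theorem hasSum_monomial (f : Hardy V n) : HasSum (fun k => monomial k (f k)) f := by
  simp only [monomial_apply]
  exact lp.hasSum_single (E := fun _ : Fin n → ℕ => V) (p := 2) ENNReal.ofNat_ne_top f

theorem clm_ext {Z : Type*} [AddCommMonoid Z] [Module ℂ Z] [TopologicalSpace Z] [T2Space Z]
    {S T : Hardy V n →L[ℂ] Z} (h : ∀ k x, S (monomial k x) = T (monomial k x)) : S = T := by
  refine ContinuousLinearMap.ext fun f => ?_
  have h₁ : HasSum (fun k => S (monomial k (f k))) (S f) :=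
    (hasSum_monomial f).map S.toLinearMap S.continuous
  have h₂ : HasSum (fun k => T (monomial k (f k))) (T f) :=
    (hasSum_monomial f).map T.toLinearMap T.continuous
  simp only [h] at h₁
  exact h₁.unique h₂

/-- The coefficientwise action of an operator. -/
def amp (n : ℕ) (L : V →L[ℂ] W) : Hardy V n →L[ℂ] Hardy W n :=
  lp.mapCLM 2 (fun _ => L) (norm_nonneg L) fun _ => le_rfl

@[simp]
theorem amp_coeff (L : V →L[ℂ] W) (f : Hardy V n) (k : Fin n → ℕ) : amp n L f k = L (f k) := rfl

theorem amp_monomial (L : V →L[ℂ] W) (k : Fin n → ℕ) (x : V) :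
    amp n L (monomial k x) = monomial k (L x) := by
  refine lp.ext (funext fun j => ?_)
  rw [amp_coeff, monomial_coeff, monomial_coeff]
  split_ifs <;> simp

theorem hasSum_shift {M : Type*} [AddCommMonoid M] [TopologicalSpace M] (k : Fin n → ℕ)
    (f : (Fin n → ℕ) → M) {a : M} :
    HasSum (fun j => if k ≤ j then f (j - k) else 0) a ↔ HasSum f a := by
  rw [← (add_left_injective k).hasSum_iff]
  · have : ((fun j => if k ≤ j then f (j - k) else 0) ∘ fun x => x + k) = f := by
      funext j
      simp
    rw [this]
  · intro j hj
    rw [if_neg]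
    intro hkj
    exact hj ⟨j - k, tsub_add_cancel_of_le hkj⟩

/-- The coefficients of `z ^ k * f z`. -/
def shiftFun (k : Fin n → ℕ) (f : (Fin n → ℕ) → V) (j : Fin n → ℕ) : V :=
  if k ≤ j then f (j - k) else 0

theorem norm_shiftFun_sq (k : Fin n → ℕ) (f : (Fin n → ℕ) → V) (j : Fin n → ℕ) :
    ‖shiftFun k f j‖ ^ 2 = if k ≤ j then ‖f (j - k)‖ ^ 2 else 0 := by
  unfold shiftFun
  split_ifs <;> simp

/-- Multiplication by the monomial `z ^ k`. -/
def shift (k : Fin n → ℕ) : Hardy V n →ₗᵢ[ℂ] Hardy V n where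
  toFun f := ⟨shiftFun k f, by
    refine memℓp_gen ?_
    have h := ((hasSum_shift k fun j => ‖f j‖ ^ 2).2 (hasSum_norm_sq f)).summable
    simpa [norm_shiftFun_sq] using h⟩
  map_add' f g := by
    refine lp.ext (funext fun j => ?_)
    change shiftFun k (f + g) j = shiftFun k f j + shiftFun k g j
    unfold shiftFun
    split_ifs <;> simp
  map_smul' c f := by
    refine lp.ext (funext fun j => ?_)
    change shiftFun k (c • f) j = c • shiftFun k f j
    unfold shiftFun
    split_ifs <;> simp
  norm_map' f := by
    have h := (hasSum_shift k fun j => ‖f j‖ ^ 2).2 (hasSum_norm_sq f)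
    rw [← sq_eq_sq₀ (norm_nonneg _) (norm_nonneg _)]
    refine (hasSum_norm_sq _).unique ?_
    simp only [← norm_shiftFun_sq] at h
    exact h

theorem shift_coeff (k j : Fin n → ℕ) (f : Hardy V n) :
    shift k f j = if k ≤ j then f (j - k) else 0 := rfl

theorem single_le_iff_ne_zero (i : Fin n) (k : Fin n → ℕ) :
    (Pi.single i 1 : Fin n → ℕ) ≤ k ↔ ¬ k i = 0 := by
  rw [← ne_eq, ← Nat.one_le_iff_ne_zero]
  refine ⟨fun h => by simpa using h i, fun h j => ?_⟩
  by_cases hj : j = i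
  · subst hj; simpa using h
  · simp [hj]

theorem shift_shift (k l : Fin n → ℕ) (f : Hardy V n) : shift k (shift l f) = shift (k + l) f := by
  refine lp.ext (funext fun j => ?_)
  simp only [shift_coeff]
  by_cases h : k ≤ j
  · rw [if_pos h, le_tsub_iff_left h, tsub_tsub]
  · rw [if_neg h, if_neg fun h' => h (le_trans (le_add_of_nonneg_right (zero_le : 0 ≤ l)) h')]

theorem shift_monomial (k l : Fin n → ℕ) (x : V) :
    shift k (monomial l x) = monomial (k + l) x := by
  refine lp.ext (funext fun j => ?_)
  rw [shift_coeff, monomial_coeff, monomial_coeff]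
  by_cases h : k ≤ j
  · simp [h, tsub_eq_iff_eq_add_of_le h, add_comm]
  · rw [if_neg h, if_neg]
    rintro rfl
    exact h (le_add_of_nonneg_right (zero_le : 0 ≤ l))

theorem amp_shift (L : V →L[ℂ] W) (k : Fin n → ℕ) (f : Hardy V n) :
    amp n L (shift k f) = shift k (amp n L f) := by
  refine lp.ext (funext fun j => ?_)
  simp only [amp_coeff, shift_coeff]
  split_ifs <;> simp

theorem adjoint_shift_coeff [CompleteSpace V] (k j : Fin n → ℕ) (f : Hardy V n) :
    ((shift k : Hardy V n →ₗᵢ[ℂ] Hardy V n).toContinuousLinearMap.adjoint f) j = f (j + k) := by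
  refine ext_inner_left ℂ fun x => ?_
  rw [← inner_monomial_left, ContinuousLinearMap.adjoint_inner_right,
    LinearIsometry.coe_toContinuousLinearMap, shift_monomial, inner_monomial_left, add_comm]

/-! ### Homogeneous elements -/

/-- `f` is homogeneous of degree `p`. -/
def IsHomog (p : ℕ) (f : Hardy V n) : Prop := ∀ k : Fin n → ℕ, ∑ i, k i ≠ p → f k = 0

theorem IsHomog.amp {p : ℕ} {f : Hardy V n} (hf : IsHomog p f) (L : V →L[ℂ] W) :
    IsHomog p (Hardy.amp n L f) := fun k hk => by simp [hf k hk]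

theorem isHomog_monomial (k : Fin n → ℕ) (x : V) :
    IsHomog (∑ i, k i) (monomial k x : Hardy V n) := fun j hj => by
  rw [monomial_coeff, if_neg]
  rintro rfl
  exact hj rfl

theorem IsHomog.inner_eq_zero {p q : ℕ} {f g : Hardy V n} (hf : IsHomog p f) (hg : IsHomog q g)
    (h : p ≠ q) : inner ℂ f g = 0 :=
  Hardy.inner_eq_zero fun k => by
    by_cases hk : ∑ i, k i = p
    · exact Or.inr (hg k (hk ▸ h))
    · exact Or.inl (hf k hk)

/-! ### The operator of multiplication by `⨁ i, z i` -/

section DiagShift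

variable {K : Fin n → Type u} [∀ i, NormedAddCommGroup (K i)] [∀ i, InnerProductSpace ℂ (K i)]

theorem norm_sq_eq_sum_proj (f : Hardy (PiLp 2 K) n) :
    ‖f‖ ^ 2 = ∑ i, ‖amp n (PiLp.proj 2 K i : PiLp 2 K →L[ℂ] K i) f‖ ^ 2 := by
  refine (hasSum_norm_sq f).unique ?_
  have := hasSum_sum (s := Finset.univ) fun i _ =>
    hasSum_norm_sq (amp n (PiLp.proj 2 K i : PiLp 2 K →L[ℂ] K i) f)
  convert this using 2 with k
  rw [PiLp.norm_sq_eq_of_L2]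
  rfl

/-- The embedding of the `i`-th summand in the Hilbert sum. -/
def piSingle (K : Fin n → Type u) [∀ i, NormedAddCommGroup (K i)]
    [∀ i, InnerProductSpace ℂ (K i)] (i : Fin n) : K i →L[ℂ] PiLp 2 K :=
  (PiLp.continuousLinearEquiv 2 ℂ K).symm.toContinuousLinearMap ∘L
    ContinuousLinearMap.single ℂ K i

theorem piSingle_apply (i j : Fin n) (x : K i) :
    (piSingle K i x) j = (Pi.single i x : ∀ i, K i) j := rfl

/-- Multiplication by `⨁ i, z i`. -/
def diagShiftL (K : Fin n → Type u) [∀ i, NormedAddCommGroup (K i)]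
    [∀ i, InnerProductSpace ℂ (K i)] : Hardy (PiLp 2 K) n →L[ℂ] Hardy (PiLp 2 K) n :=
  ∑ i, amp n (piSingle K i) ∘L
    (shift (Pi.single i 1) : Hardy (K i) n →ₗᵢ[ℂ] Hardy (K i) n).toContinuousLinearMap ∘L
      amp n (PiLp.proj 2 K i)

theorem diagShiftL_coeff (f : Hardy (PiLp 2 K) n) (k : Fin n → ℕ) (i : Fin n) :
    (diagShiftL K f) k i = if k i = 0 then 0 else f (k - Pi.single i 1) i := by
  have h : (diagShiftL K f) k = ∑ j, piSingle K j
      ((shift (Pi.single j 1) (amp n (PiLp.proj 2 K j : PiLp 2 K →L[ℂ] K j) f) :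
        Hardy (K j) n) k) := by
    simp only [diagShiftL, sum_apply, lp.coeFn_sum, Finset.sum_apply]
    rfl
  rw [h, WithLp.ofLp_sum, Finset.sum_apply, Finset.sum_eq_single i]
  · rw [piSingle_apply, Pi.single_eq_same, shift_coeff]
    have := single_le_iff_ne_zero i k
    by_cases hk : k i = 0 <;> simp [this, hk]
  · intro j _ hj
    rw [piSingle_apply, Pi.single_eq_of_ne hj.symm]
  · simp

theorem amp_proj_diagShiftL (f : Hardy (PiLp 2 K) n) (i : Fin n) :
    amp n (PiLp.proj 2 K i : PiLp 2 K →L[ℂ] K i) (diagShiftL K f) =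
      shift (Pi.single i 1) (amp n (PiLp.proj 2 K i) f) := by
  refine lp.ext (funext fun k => ?_)
  rw [shift_coeff]
  refine (diagShiftL_coeff f k i).trans ?_
  have := single_le_iff_ne_zero i k
  by_cases hk : k i = 0 <;> simp [this, hk]

/-- Multiplication by `⨁ i, z i` as an isometry. -/
def diagShift (K : Fin n → Type u) [∀ i, NormedAddCommGroup (K i)]
    [∀ i, InnerProductSpace ℂ (K i)] : Hardy (PiLp 2 K) n →ₗᵢ[ℂ] Hardy (PiLp 2 K) n where
  toLinearMap := (diagShiftL K).toLinearMap
  norm_map' f := by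
    rw [← sq_eq_sq₀ (norm_nonneg _) (norm_nonneg _), norm_sq_eq_sum_proj, norm_sq_eq_sum_proj]
    simp only [ContinuousLinearMap.coe_coe, amp_proj_diagShiftL, LinearIsometry.norm_map]

theorem diagShift_coeff (f : Hardy (PiLp 2 K) n) (k : Fin n → ℕ) (i : Fin n) :
    (diagShift K f) k i = if k i = 0 then 0 else f (k - Pi.single i 1) i :=
  diagShiftL_coeff f k i

theorem ext_proj {f g : Hardy (PiLp 2 K) n}
    (h : ∀ i, amp n (PiLp.proj 2 K i : PiLp 2 K →L[ℂ] K i) f = amp n (PiLp.proj 2 K i) g) :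
    f = g := by
  refine lp.ext (funext fun k => PiLp.ext fun i => ?_)
  exact congrArg (fun f : Hardy (K i) n => f k) (h i)

theorem amp_proj_diagShift (f : Hardy (PiLp 2 K) n) (i : Fin n) :
    amp n (PiLp.proj 2 K i : PiLp 2 K →L[ℂ] K i) (diagShift K f) =
      shift (Pi.single i 1) (amp n (PiLp.proj 2 K i) f) :=
  amp_proj_diagShiftL f i

theorem diagShift_shift (k : Fin n → ℕ) (f : Hardy (PiLp 2 K) n) :
    diagShift K (shift k f) = shift k (diagShift K f) := by
  refine ext_proj fun i => ?_
  rw [amp_proj_diagShift, amp_shift, amp_shift, amp_proj_diagShift, shift_shift, shift_shift,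
    add_comm]

/-- On the `i`-th summand `E(z)` is the scalar `z i`; the Hilbert–Schmidt argument uses this on an
adapted basis. -/
theorem diagShift_monomial_piSingle (k : Fin n → ℕ) (i : Fin n) (x : K i) :
    diagShift K (monomial k (piSingle K i x)) =
      shift (Pi.single i 1) (monomial k (piSingle K i x)) := by
  refine ext_proj fun j => ?_
  rw [amp_proj_diagShift, amp_shift, amp_monomial]
  by_cases hj : j = i
  · subst hj; rfl
  · have : (PiLp.proj 2 K j : PiLp 2 K →L[ℂ] K j) (piSingle K i x) = 0 :=
      (piSingle_apply i j x).trans (Pi.single_eq_of_ne hj _)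
    simp [this]

theorem IsHomog.diagShift {p : ℕ} {f : Hardy (PiLp 2 K) n} (hf : IsHomog p f) :
    IsHomog (p + 1) (Hardy.diagShift K f) := fun k hk => by
  refine PiLp.ext fun i => ?_
  rw [diagShift_coeff]
  split_ifs with hi
  · rfl
  · rw [hf]
    case neg.a =>
      have hsub : k - Pi.single i 1 + Pi.single i 1 = k := by
        funext j
        by_cases hj : j = i
        · subst hj; simp; omega
        · simp [hj]
      have := sum_add_single (k - Pi.single i 1) i
      rw [hsub] at this
      omega

end DiagShift

end Hardy

/-! ### The blocks of a unitary colligation -/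

section Colligation

variable {E : Type u} [NormedAddCommGroup E] [InnerProductSpace ℂ E]
variable {n : ℕ} {K : Fin n → Type u} [∀ i, NormedAddCommGroup (K i)]
  [∀ i, InnerProductSpace ℂ (K i)]
variable (U : WithLp 2 (E × PiLp 2 K) ≃ₗᵢ[ℂ] WithLp 2 (E × PiLp 2 K))

/-- The block `A` of `U = [A B; C D]`. -/
def blockA : E →L[ℂ] E :=
  WithLp.fstL 2 ℂ E (PiLp 2 K) ∘L U.toContinuousLinearEquiv.toContinuousLinearMap ∘L
    inlL E (PiLp 2 K)

/-- The block `B` of `U = [A B; C D]`. -/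
def blockB : PiLp 2 K →L[ℂ] E :=
  WithLp.fstL 2 ℂ E (PiLp 2 K) ∘L U.toContinuousLinearEquiv.toContinuousLinearMap ∘L
    inrL E (PiLp 2 K)

/-- The block `C` of `U = [A B; C D]`. -/
def blockC : E →L[ℂ] PiLp 2 K :=
  WithLp.sndL 2 ℂ E (PiLp 2 K) ∘L U.toContinuousLinearEquiv.toContinuousLinearMap ∘L
    inlL E (PiLp 2 K)

/-- The block `D` of `U = [A B; C D]`. -/
def blockD : PiLp 2 K →L[ℂ] PiLp 2 K :=
  WithLp.sndL 2 ℂ E (PiLp 2 K) ∘L U.toContinuousLinearEquiv.toContinuousLinearMap ∘L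
    inrL E (PiLp 2 K)

theorem toLp_eq_add (x : E) (y : PiLp 2 K) :
    (WithLp.toLp 2 (x, y) : WithLp 2 (E × PiLp 2 K)) =
      inlL E (PiLp 2 K) x + inrL E (PiLp 2 K) y := by
  change _ = (WithLp.toLp 2 (x, 0) : WithLp 2 (E × PiLp 2 K)) + WithLp.toLp 2 (0, y)
  rw [← WithLp.toLp_add]
  simp

theorem apply_toLp (x : E) (y : PiLp 2 K) :
    U (WithLp.toLp 2 (x, y)) =
      WithLp.toLp 2 (blockA U x + blockB U y, blockC U x + blockD U y) := by
  rw [toLp_eq_add, map_add]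
  rfl

theorem inner_block (x x' : E) (y y' : PiLp 2 K) :
    inner ℂ (blockA U x + blockB U y) (blockA U x' + blockB U y') +
        inner ℂ (blockC U x + blockD U y) (blockC U x' + blockD U y') =
      inner ℂ x x' + inner ℂ y y' := by
  have := U.inner_map_map (WithLp.toLp 2 (x, y)) (WithLp.toLp 2 (x', y'))
  rw [apply_toLp, apply_toLp, WithLp.prod_inner_apply, WithLp.prod_inner_apply] at this
  exact this

/-! ### Homogeneous expansion of multiplication by the transfer function -/

namespace Hardy

theorem inner_amp_block (f f' : Hardy E n) (g g' : Hardy (PiLp 2 K) n) :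
    inner ℂ (amp n (blockA U) f + amp n (blockB U) g)
        (amp n (blockA U) f' + amp n (blockB U) g') +
      inner ℂ (amp n (blockC U) f + amp n (blockD U) g)
        (amp n (blockC U) f' + amp n (blockD U) g') =
      inner ℂ f f' + inner ℂ g g' := by
  refine ((lp.hasSum_inner _ _).add (lp.hasSum_inner _ _)).unique ?_
  convert (lp.hasSum_inner (𝕜 := ℂ) f f').add (lp.hasSum_inner (𝕜 := ℂ) g g') using 2 with k
  exact inner_block U (f k) (f' k) (g k) (g' k)

/-- Multiplication by `D E(z)`. -/
def stateOp : Hardy (PiLp 2 K) n →L[ℂ] Hardy (PiLp 2 K) n :=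
  amp n (blockD U) ∘L (diagShift K).toContinuousLinearMap

theorem stateOp_apply (g : Hardy (PiLp 2 K) n) :
    stateOp U g = amp n (blockD U) (diagShift K g) := rfl

theorem stateOp_pow_shift (m : ℕ) (k : Fin n → ℕ) (g : Hardy (PiLp 2 K) n) :
    (stateOp U ^ m) (shift k g) = shift k ((stateOp U ^ m) g) := by
  induction m with
  | zero => rfl
  | succ m ih =>
    rw [pow_succ', mul_apply_eq_comp, mul_apply_eq_comp, ih, stateOp_apply, stateOp_apply,
      diagShift_shift, amp_shift]

theorem IsHomog.stateOp_pow {p : ℕ} {g : Hardy (PiLp 2 K) n} (hg : IsHomog p g) (m : ℕ) :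
    IsHomog (p + m) ((stateOp U ^ m) g) := by
  induction m with
  | zero => exact hg
  | succ m ih =>
    rw [pow_succ', mul_apply_eq_comp, stateOp_apply]
    exact ih.diagShift.amp _

/-- The coefficient of degree `m` in `C + D E(z) C + (D E(z)) ^ 2 C + ...`, applied to `x`. -/
def stateTerm (m : ℕ) : Hardy E n →L[ℂ] Hardy (PiLp 2 K) n := (stateOp U ^ m) ∘L amp n (blockC U)

theorem stateTerm_apply (m : ℕ) (x : Hardy E n) :
    stateTerm U m x = (stateOp U ^ m) (amp n (blockC U) x) := rfl

theorem stateTerm_succ (m : ℕ) (x : Hardy E n) :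
    stateTerm U (m + 1) x = stateOp U (stateTerm U m x) := by
  rw [stateTerm_apply, pow_succ', mul_apply_eq_comp, stateTerm_apply]

theorem stateTerm_shift (m : ℕ) (k : Fin n → ℕ) (x : Hardy E n) :
    stateTerm U m (shift k x) = shift k (stateTerm U m x) := by
  rw [stateTerm_apply, amp_shift, stateOp_pow_shift, stateTerm_apply]

theorem IsHomog.stateTerm {p : ℕ} {x : Hardy E n} (hx : IsHomog p x) (m : ℕ) :
    IsHomog (p + m) (Hardy.stateTerm U m x) := (hx.amp _).stateOp_pow U m

/-- The partial sums of `(C + D E(z) C + (D E(z)) ^ 2 C + ...) x`. -/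
def stateSum (p : ℕ) (x : Hardy E n) : Hardy (PiLp 2 K) n :=
  ∑ m ∈ Finset.range p, stateTerm U m x

theorem stateSum_succ (p : ℕ) (x : Hardy E n) :
    stateSum U (p + 1) x = stateSum U p x + stateTerm U p x := Finset.sum_range_succ _ _

theorem stateSum_succ' (p : ℕ) (x : Hardy E n) :
    stateSum U (p + 1) x = amp n (blockC U) x + stateOp U (stateSum U p x) := by
  rw [stateSum, Finset.sum_range_succ', add_comm, stateSum, map_sum]
  simp only [stateTerm_succ]
  rfl

/-- The homogeneous terms of multiplication by `A + B E(z) (1 - D E(z))⁻¹ C`. -/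
def multTerm : ℕ → Hardy E n →L[ℂ] Hardy E n
  | 0 => amp n (blockA U)
  | m + 1 => amp n (blockB U) ∘L (diagShift K).toContinuousLinearMap ∘L stateTerm U m

theorem multTerm_succ (m : ℕ) (x : Hardy E n) :
    multTerm U (m + 1) x = amp n (blockB U) (diagShift K (stateTerm U m x)) := rfl

theorem multTerm_shift (m : ℕ) (k : Fin n → ℕ) (x : Hardy E n) :
    multTerm U m (shift k x) = shift k (multTerm U m x) := by
  cases m with
  | zero => exact amp_shift _ _ _
  | succ m => rw [multTerm_succ, stateTerm_shift, diagShift_shift, amp_shift, multTerm_succ]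

theorem IsHomog.multTerm {p : ℕ} {x : Hardy E n} (hx : IsHomog p x) (m : ℕ) :
    IsHomog (p + m) (Hardy.multTerm U m x) := by
  cases m with
  | zero => exact hx.amp _
  | succ m => exact (hx.stateTerm U m).diagShift.amp _

/-- The partial sums of multiplication by `A + B E(z) (1 - D E(z))⁻¹ C`. -/
def multSum (p : ℕ) (x : Hardy E n) : Hardy E n := ∑ m ∈ Finset.range (p + 1), multTerm U m x

theorem multSum_eq (p : ℕ) (x : Hardy E n) :
    multSum U p x = amp n (blockA U) x + amp n (blockB U) (diagShift K (stateSum U p x)) := by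
  rw [multSum, Finset.sum_range_succ', add_comm, stateSum, map_sum, map_sum]
  rfl

theorem multSum_shift (p : ℕ) (k : Fin n → ℕ) (x : Hardy E n) :
    multSum U p (shift k x) = shift k (multSum U p x) := by
  simp only [multSum, multTerm_shift, map_sum]

/-- Applied coefficientwise, `U` sends `(x, diagShift (stateSum p x))` to `(multSum p x, stateSum (p
+ 1) x)`, and `diagShift` is isometric. The two cutoffs are independent. -/
theorem inner_multSum_add (p q : ℕ) (x y : Hardy E n) :
    inner ℂ (multSum U p x) (multSum U q y) +
        inner ℂ (stateSum U (p + 1) x) (stateSum U (q + 1) y) =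
      inner ℂ x y + inner ℂ (stateSum U p x) (stateSum U q y) := by
  rw [multSum_eq, multSum_eq, stateSum_succ', stateSum_succ', stateOp_apply, stateOp_apply,
    inner_amp_block, LinearIsometry.inner_map_map]

theorem inner_stateSum_stateTerm {a b p q : ℕ} {x y : Hardy E n} (hx : IsHomog a x)
    (hy : IsHomog b y) (h : a + p = b + q) :
    inner ℂ (stateSum U p x) (stateTerm U q y) = 0 := by
  rw [stateSum, sum_inner]
  refine Finset.sum_eq_zero fun m hm => (hx.stateTerm U m).inner_eq_zero (hy.stateTerm U q) ?_
  rw [Finset.mem_range] at hm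
  omega

/-- In `inner_multSum_add` the last state terms have the same degree `a + p = b + q`, above every
degree in both partial sums, so the cross terms vanish. -/
theorem inner_multSum {a b p q : ℕ} {x y : Hardy E n} (hx : IsHomog a x)
    (hy : IsHomog b y) (h : a + p = b + q) :
    inner ℂ (multSum U p x) (multSum U q y) =
      inner ℂ x y - inner ℂ (stateTerm U p x) (stateTerm U q y) := by
  have h₁ := inner_multSum_add U p q x y
  rw [stateSum_succ, stateSum_succ, inner_add_left, inner_add_right, inner_add_right,
    inner_stateSum_stateTerm U hx hy h, ← inner_conj_symm (stateTerm U p x) (stateSum U q y),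
    inner_stateSum_stateTerm U hy hx h.symm, map_zero] at h₁
  linear_combination h₁

theorem norm_sq_block_zero_left (g : Hardy (PiLp 2 K) n) :
    ‖amp n (blockB U) g‖ ^ 2 + ‖amp n (blockD U) g‖ ^ 2 = ‖g‖ ^ 2 := by
  have := inner_amp_block U 0 0 g g
  rw [inner_zero_left] at this
  simp only [map_zero, zero_add, inner_self_eq_norm_sq_to_K] at this
  exact_mod_cast this

theorem norm_sq_block_zero_right (f : Hardy E n) :
    ‖amp n (blockA U) f‖ ^ 2 + ‖amp n (blockC U) f‖ ^ 2 = ‖f‖ ^ 2 := by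
  have := inner_amp_block U f f 0 0
  rw [inner_zero_left] at this
  simp only [map_zero, add_zero, inner_self_eq_norm_sq_to_K] at this
  exact_mod_cast this

/-- At each step the norm of the state splits between the output through `B` and the next state
through `D`. -/
theorem sum_norm_sq_multTerm (p : ℕ) (x : Hardy E n) :
    ∑ m ∈ Finset.range (p + 1), ‖multTerm U m x‖ ^ 2 = ‖x‖ ^ 2 - ‖stateTerm U p x‖ ^ 2 := by
  induction p with
  | zero =>
    have := norm_sq_block_zero_right U x
    rw [Finset.sum_range_one]
    exact eq_sub_of_add_eq this
  | succ p ih =>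
    have := norm_sq_block_zero_left U (diagShift K (stateTerm U p x))
    rw [Finset.sum_range_succ, ih, multTerm_succ, stateTerm_succ, stateOp_apply]
    rw [LinearIsometry.norm_map] at this
    linarith

/-- The subspace of homogeneous elements of degree `p`. -/
def homogSubmodule (V : Type u) [NormedAddCommGroup V] [InnerProductSpace ℂ V] (n p : ℕ) :
    Submodule ℂ (Hardy V n) where
  carrier := {f | IsHomog p f}
  add_mem' hf hg k hk := by simp [hf k hk, hg k hk]
  zero_mem' k _ := rfl
  smul_mem' c f hf k hk := by simp [hf k hk]

theorem orthogonalFamily_homogSubmodule (V : Type u) [NormedAddCommGroup V]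
    [InnerProductSpace ℂ V] (n : ℕ) :
    OrthogonalFamily ℂ (fun p => homogSubmodule V n p) fun p =>
      (homogSubmodule V n p).subtypeₗᵢ :=
  fun _ _ hpq f g => IsHomog.inner_eq_zero f.2 g.2 hpq

/-- The terms have distinct degrees, hence are orthogonal, and their squared norms sum to at most
`‖x‖ ^ 2`. -/
theorem summable_multTerm [CompleteSpace E] (x : E) :
    Summable fun m => multTerm U m (monomial 0 x : Hardy E n) := by
  have hx : IsHomog 0 (monomial 0 x : Hardy E n) := by
    simpa using isHomog_monomial (0 : Fin n → ℕ) x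
  have hf : ∀ m, multTerm U m (monomial 0 x : Hardy E n) ∈ homogSubmodule E n m := fun m => by
    simpa using! hx.multTerm U m
  refine ((orthogonalFamily_homogSubmodule E n).summable_iff_norm_sq_summable
    fun m => ⟨_, hf m⟩).2 ?_
  refine summable_of_sum_range_le (c := ‖(monomial 0 x : Hardy E n)‖ ^ 2)
    (fun _ => sq_nonneg _) fun m => ?_
  refine (Finset.sum_le_sum_of_subset_of_nonneg (Finset.range_mono (Nat.le_succ m))
    fun _ _ _ => sq_nonneg _).trans ((sum_norm_sq_multTerm U m (monomial 0 x)).le.trans ?_)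
  linarith [sq_nonneg ‖stateTerm U m (monomial 0 x : Hardy E n)‖]

theorem tendsto_multSum [CompleteSpace E] (x : E) :
    Tendsto (fun p => multSum U p (monomial 0 x)) atTop
      (𝓝 (∑' m, multTerm U m (monomial 0 x : Hardy E n))) :=
  ((summable_multTerm U x).hasSum.tendsto_sum_nat).comp (tendsto_add_atTop_nat 1)

end Hardy

end Colligation

/-! ### The Hilbert–Schmidt norm -/

/-- Both sums are the trace of `M⋆ M`. -/
theorem sum_norm_sq_orthonormalBasis {V Z ι κ : Type*} [NormedAddCommGroup V]
    [InnerProductSpace ℂ V] [CompleteSpace V] [NormedAddCommGroup Z] [InnerProductSpace ℂ Z]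
    [CompleteSpace Z] [Fintype ι] [Fintype κ] (M : V →L[ℂ] Z) (b : OrthonormalBasis ι ℂ V)
    (b' : OrthonormalBasis κ ℂ V) : ∑ i, ‖M (b i)‖ ^ 2 = ∑ j, ‖M (b' j)‖ ^ 2 := by
  have key : ∀ x : V, inner ℂ x ((M.adjoint ∘L M) x) = ((‖M x‖ ^ 2 : ℝ) : ℂ) := by
    intro x
    rw [ContinuousLinearMap.comp_apply, ContinuousLinearMap.adjoint_inner_right,
      inner_self_eq_norm_sq_to_K]
    simp
  have h₁ := LinearMap.trace_eq_sum_inner (M.adjoint ∘L M).toLinearMap b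
  have h₂ := LinearMap.trace_eq_sum_inner (M.adjoint ∘L M).toLinearMap b'
  rw [h₁] at h₂
  simp only [ContinuousLinearMap.coe_coe, key] at h₂
  exact_mod_cast h₂

/-! ### Decay of the state terms and the inner multiplier -/

section Colligation

variable {E : Type u} [NormedAddCommGroup E] [InnerProductSpace ℂ E]
variable {n : ℕ} {K : Fin n → Type u} [∀ i, NormedAddCommGroup (K i)]
  [∀ i, InnerProductSpace ℂ (K i)] [CompleteSpace E] [∀ i, CompleteSpace (K i)]
  [FiniteDimensional ℂ E] [∀ i, FiniteDimensional ℂ (K i)]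
variable (U : WithLp 2 (E × PiLp 2 K) ≃ₗᵢ[ℂ] WithLp 2 (E × PiLp 2 K))

namespace Hardy

/-- An orthonormal basis of a finite-dimensional Hilbert sum adapted to the summands. -/
def piBasis (K : Fin n → Type u) [∀ i, NormedAddCommGroup (K i)]
    [∀ i, InnerProductSpace ℂ (K i)] [∀ i, FiniteDimensional ℂ (K i)] :
    OrthonormalBasis ((i : Fin n) × Fin (Module.finrank ℂ (K i))) ℂ (PiLp 2 K) :=
  Pi.orthonormalBasis fun i => stdOrthonormalBasis ℂ (K i)

theorem norm_stateOp_pow_succ_piBasis (m : ℕ)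
    (j : (i : Fin n) × Fin (Module.finrank ℂ (K i))) :
    ‖(stateOp U ^ (m + 1)) (monomial 0 (piBasis K j))‖ =
      ‖(stateOp U ^ m) (monomial 0 (blockD U (piBasis K j)))‖ := by
  have hj : piBasis K j = piSingle K j.1 (stdOrthonormalBasis ℂ (K j.1) j.2) :=
    (Pi.orthonormalBasis_apply _ j).trans rfl
  rw [pow_succ, mul_apply_eq_comp, stateOp_apply, hj, diagShift_monomial_piSingle, amp_shift,
    stateOp_pow_shift, amp_monomial, LinearIsometry.norm_map]

/-- Compare the Hilbert–Schmidt norm of `N`, which acts by `stateOp U ^ m` on the second component,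
in a basis `b` and in its image under `U`. In `b` the `E` vectors contribute nothing; in the image
they give the `C` terms, and the others give `D` terms, which are the next power. -/
theorem sum_norm_sq_stateOp (m : ℕ) :
    ∑ j, ‖(stateOp U ^ m) (monomial 0 (piBasis K j))‖ ^ 2 =
      ∑ j, ‖(stateOp U ^ m) (monomial 0 (blockC U (stdOrthonormalBasis ℂ E j)))‖ ^ 2 +
        ∑ j, ‖(stateOp U ^ (m + 1)) (monomial 0 (piBasis K j))‖ ^ 2 := by
  let N : WithLp 2 (E × PiLp 2 K) →L[ℂ] Hardy (PiLp 2 K) n :=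
    (stateOp U ^ m) ∘L monomial 0 ∘L WithLp.sndL 2 ℂ E (PiLp 2 K)
  have hN : ∀ x y, N (WithLp.toLp 2 (x, y)) = (stateOp U ^ m) (monomial 0 y) := fun _ _ => rfl
  let b := (stdOrthonormalBasis ℂ E).prod (piBasis K)
  have h := sum_norm_sq_orthonormalBasis N b (b.map U)
  simp only [b, OrthonormalBasis.map_apply, Fintype.sum_sum_type, OrthonormalBasis.prod_apply,
    Sum.elim_inl, Sum.elim_inr, Function.comp_apply, LinearMap.inl_apply, LinearMap.inr_apply,
    apply_toLp, hN, map_zero, norm_zero, add_zero, zero_add] at h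
  simp only [norm_stateOp_pow_succ_piBasis]
  simpa using h

/-- The sequence `a` is nonnegative and decreasing, so its successive differences tend to zero; by
`sum_norm_sq_stateOp` they dominate the squared state terms of a basis of `E`. -/
theorem tendsto_stateTerm (x : E) :
    Tendsto (fun m => stateTerm U m (monomial 0 x : Hardy E n)) atTop (𝓝 0) := by
  let a : ℕ → ℝ := fun m => ∑ j, ‖(stateOp U ^ m) (monomial 0 (piBasis K j))‖ ^ 2
  have ha : Antitone a := antitone_nat_of_succ_le fun m => by
    have := sum_norm_sq_stateOp U m
    have h₀ : 0 ≤ ∑ j, ‖(stateOp U ^ m) (monomial 0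
      (blockC U (stdOrthonormalBasis ℂ E j)))‖ ^ 2 := Finset.sum_nonneg fun _ _ => sq_nonneg _
    simp only [a]
    linarith
  have hbdd : BddBelow (Set.range a) :=
    ⟨0, by rintro _ ⟨m, rfl⟩; exact Finset.sum_nonneg fun _ _ => sq_nonneg _⟩
  have hlim := tendsto_atTop_ciInf ha hbdd
  have hdiff : Tendsto (fun m => a m - a (m + 1)) atTop (𝓝 0) := by
    simpa using hlim.sub (hlim.comp (tendsto_add_atTop_nat 1))
  have hb : ∀ j, Tendsto (fun m => (stateOp U ^ m) (monomial 0
      (blockC U (stdOrthonormalBasis ℂ E j)))) atTop (𝓝 0) := by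
    intro j
    rw [tendsto_zero_iff_norm_tendsto_zero]
    suffices h : Tendsto (fun m => ‖(stateOp U ^ m) (monomial 0
        (blockC U (stdOrthonormalBasis ℂ E j)))‖ ^ 2) atTop (𝓝 0) by
      simpa [Real.sqrt_sq] using h.sqrt
    refine squeeze_zero (fun _ => sq_nonneg _) (fun m => ?_) hdiff
    have := sum_norm_sq_stateOp U m
    have h₁ := Finset.single_le_sum (f := fun j => ‖(stateOp U ^ m) (monomial 0
      (blockC U (stdOrthonormalBasis ℂ E j)))‖ ^ 2) (fun _ _ => sq_nonneg _) (Finset.mem_univ j)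
    simp only [a]
    linarith
  have hx : ∀ m, stateTerm U m (monomial 0 x : Hardy E n) =
      ∑ j, inner ℂ (stdOrthonormalBasis ℂ E j) x • (stateOp U ^ m) (monomial 0
        (blockC U (stdOrthonormalBasis ℂ E j))) := by
    intro m
    rw [stateTerm_apply, amp_monomial]
    conv_lhs => rw [← (stdOrthonormalBasis ℂ E).sum_repr' x]
    simp only [map_sum, map_smul]
  simp only [hx]
  simpa using tendsto_finsetSum Finset.univ fun j _ =>
    (hb j).const_smul (inner ℂ (stdOrthonormalBasis ℂ E j) x)

theorem tendsto_inner_multSum (k l : Fin n → ℕ) (x y : E) :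
    inner ℂ (shift k (∑' m, multTerm U m (monomial 0 x)) : Hardy E n)
        (shift l (∑' m, multTerm U m (monomial 0 y))) =
      inner ℂ (monomial k x : Hardy E n) (monomial l y) := by
  have hlim : ∀ (k : Fin n → ℕ) (x : E) (a : ℕ),
      Tendsto (fun p => multSum U (p + a) (monomial k x)) atTop
        (𝓝 (shift k (∑' m, multTerm U m (monomial 0 x)))) := by
    intro k x a
    have h := (((shift k : Hardy E n →ₗᵢ[ℂ] Hardy E n).continuous.tendsto _).comp
      (tendsto_multSum U x)).comp (tendsto_add_atTop_nat a)
    refine h.congr fun p => ?_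
    simp only [Function.comp_apply, ← multSum_shift, shift_monomial, add_zero]
  have hlim0 : ∀ (k : Fin n → ℕ) (x : E) (a : ℕ),
      Tendsto (fun p => stateTerm U (p + a) (monomial k x)) atTop (𝓝 0) := by
    intro k x a
    have h := (((shift k : Hardy (PiLp 2 K) n →ₗᵢ[ℂ] _).continuous.tendsto _).comp
      (tendsto_stateTerm U x)).comp (tendsto_add_atTop_nat a)
    rw [map_zero] at h
    refine h.congr fun p => ?_
    simp only [Function.comp_apply, ← stateTerm_shift, shift_monomial, add_zero]
  -- The cutoffs are offset by each other's degree, so that both end at total degree `p + |k| +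
  -- |l|`, as `inner_multSum` requires.
  have h₁ := (hlim k x (∑ i, l i)).inner (𝕜 := ℂ) (hlim l y (∑ i, k i))
  have h₂ := (hlim0 k x (∑ i, l i)).inner (𝕜 := ℂ) (hlim0 l y (∑ i, k i))
  rw [inner_zero_left] at h₂
  refine tendsto_nhds_unique h₁ ?_
  have h₃ := (tendsto_const_nhds (x := inner ℂ (monomial k x : Hardy E n) (monomial l y))).sub h₂
  rw [sub_zero] at h₃
  refine h₃.congr fun p => ?_
  rw [inner_multSum U (isHomog_monomial k x) (isHomog_monomial l y) (by ring)]

/-- The inner function `A + B E(z) (1 - D E(z))⁻¹ C` applied to constants. -/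
def innerVec : E →ₗᵢ[ℂ] Hardy E n where
  toFun x := ∑' m, multTerm U m (monomial 0 x)
  map_add' x y := by
    rw [← (summable_multTerm U x).tsum_add (summable_multTerm U y)]
    simp only [map_add]
  map_smul' c x := by
    rw [RingHom.id_apply, ← (summable_multTerm U x).tsum_const_smul c]
    simp only [map_smul]
  norm_map' x := by
    have h := tendsto_inner_multSum U 0 0 x x
    rw [LinearIsometry.inner_map_map, inner_self_eq_norm_sq_to_K, inner_self_eq_norm_sq_to_K,
      norm_monomial] at h
    have h' : ‖(∑' m, multTerm U m (monomial 0 x) : Hardy E n)‖ ^ 2 = ‖x‖ ^ 2 := by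
      exact_mod_cast h
    exact (sq_eq_sq₀ (norm_nonneg _) (norm_nonneg _)).1 h'

theorem tendsto_innerVec (x : E) :
    Tendsto (fun p => multSum U p (monomial 0 x)) atTop (𝓝 (innerVec U x)) :=
  tendsto_multSum U x

theorem orthogonalFamily_innerVec :
    OrthogonalFamily ℂ (fun _ : Fin n → ℕ => E) fun k => (shift k).comp (innerVec U) := by
  intro k l hkl x y
  refine (tendsto_inner_multSum U k l x y).trans ?_
  rw [inner_monomial_left, monomial_coeff, if_neg hkl, inner_zero_right]

/-- Multiplication by the inner function `A + B E(z) (1 - D E(z))⁻¹ C`. -/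
def innerMult : Hardy E n →ₗᵢ[ℂ] Hardy E n := (orthogonalFamily_innerVec U).linearIsometry

theorem innerMult_monomial (k : Fin n → ℕ) (x : E) :
    innerMult U (monomial k x) = shift k (innerVec U x) :=
  (orthogonalFamily_innerVec U).linearIsometry_apply_single x

theorem innerMult_shift (k : Fin n → ℕ) (f : Hardy E n) :
    innerMult U (shift k f) = shift k (innerMult U f) := by
  have : (innerMult U).toContinuousLinearMap ∘L (shift k).toContinuousLinearMap =
      (shift k).toContinuousLinearMap ∘L (innerMult U).toContinuousLinearMap :=
    clm_ext fun l x => by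
      simp [shift_monomial, innerMult_monomial, shift_shift]
  exact congrArg (fun T => T f) this

end Hardy

end Colligation

namespace Hardy

/-! ### Point evaluations -/

theorem summable_prod_pow : ∀ {n : ℕ} (r : Fin n → ℝ) (_ : ∀ i, 0 ≤ r i) (_ : ∀ i, r i < 1),
    Summable fun k : Fin n → ℕ => ∏ i, r i ^ k i
  | 0, _, _, _ => (hasSum_unique _).summable
  | n + 1, r, h₀, h₁ => by
    rw [← (Fin.consEquiv fun _ => ℕ).summable_iff]
    have h := (summable_geometric_of_lt_one (h₀ 0) (h₁ 0)).mul_of_nonneg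
      (summable_prod_pow (fun i => r i.succ) (fun i => h₀ _) fun i => h₁ _)
      (fun k => pow_nonneg (h₀ 0) k)
      (fun k => Finset.prod_nonneg fun i _ => pow_nonneg (h₀ _) _)
    refine h.congr fun p => ?_
    simp [Fin.prod_univ_succ, Fin.consEquiv]

section Eval

variable {V W : Type u} [NormedAddCommGroup V] [InnerProductSpace ℂ V] [CompleteSpace V]
  [NormedAddCommGroup W] [InnerProductSpace ℂ W] {n : ℕ}

theorem summable_weight {z : Fin n → ℂ} (hz : z ∈ polydisc n) :
    Summable fun k : Fin n → ℕ => ‖∏ i, z i ^ k i‖ ^ 2 := by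
  have h := summable_prod_pow (fun i => ‖z i‖ ^ 2) (fun i => sq_nonneg _)
    fun i => pow_lt_one₀ (norm_nonneg _) (hz i) two_ne_zero
  refine h.congr fun k => ?_
  rw [norm_prod, ← Finset.prod_pow]
  refine Finset.prod_congr rfl fun i _ => ?_
  rw [norm_pow, ← pow_mul, ← pow_mul, mul_comm]

/-- Cauchy–Schwarz against the square-summable weights `z ^ k`. -/
theorem summable_norm_eval {z : Fin n → ℂ} (hz : z ∈ polydisc n) (f : Hardy V n) :
    (Summable fun k : Fin n → ℕ => ‖(∏ i, z i ^ k i) • f k‖) ∧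
      ∑' k : Fin n → ℕ, ‖(∏ i, z i ^ k i) • f k‖ ≤
        √(∑' k : Fin n → ℕ, ‖∏ i, z i ^ k i‖ ^ 2) * ‖f‖ := by
  have h := Real.summable_and_inner_le_Lp_mul_Lq_tsum_of_nonneg (p := 2) (q := 2)
    Real.HolderConjugate.two_two (f := fun k : Fin n → ℕ => ‖∏ i, z i ^ k i‖)
    (g := fun k => ‖f k‖) (fun _ => norm_nonneg _) (fun _ => norm_nonneg _)
    (by simpa using summable_weight hz) (by simpa using (hasSum_norm_sq f).summable)
  simp only [norm_smul]
  refine ⟨h.1, h.2.trans (le_of_eq ?_)⟩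
  simp only [Real.rpow_two, (hasSum_norm_sq f).tsum_eq, ← Real.sqrt_eq_rpow]
  rw [Real.sqrt_sq (norm_nonneg _)]

theorem summable_eval {z : Fin n → ℂ} (hz : z ∈ polydisc n) (f : Hardy V n) :
    Summable fun k : Fin n → ℕ => (∏ i, z i ^ k i) • f k :=
  (summable_norm_eval hz f).1.of_norm

/-- Evaluation at a point of the polydisc. -/
def evalCLM {z : Fin n → ℂ} (hz : z ∈ polydisc n) : Hardy V n →L[ℂ] V :=
  LinearMap.mkContinuous
    { toFun := fun f => Hardy.eval f z
      map_add' := fun f g => by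
        simp only [Hardy.eval]
        rw [← (summable_eval hz f).tsum_add (summable_eval hz g)]
        simp
      map_smul' := fun c f => by
        simp only [Hardy.eval, RingHom.id_apply]
        rw [← (summable_eval hz f).tsum_const_smul c]
        simp only [lp.coeFn_smul, Pi.smul_apply]
        exact tsum_congr fun k => smul_comm _ _ _ }
    (√(∑' k : Fin n → ℕ, ‖∏ i, z i ^ k i‖ ^ 2))
    fun f => (norm_tsum_le_tsum_norm (summable_norm_eval hz f).1).trans (summable_norm_eval hz f).2

theorem evalCLM_apply {z : Fin n → ℂ} (hz : z ∈ polydisc n) (f : Hardy V n) :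
    evalCLM hz f = Hardy.eval f z := rfl

theorem eval_monomial (k : Fin n → ℕ) (x : V) (z : Fin n → ℂ) :
    Hardy.eval (monomial k x : Hardy V n) z = (∏ i, z i ^ k i) • x := by
  rw [Hardy.eval, tsum_eq_single k]
  · rw [monomial_coeff, if_pos rfl]
  · intro j hj
    rw [monomial_coeff, if_neg hj, smul_zero]

theorem eval_amp [CompleteSpace W] {z : Fin n → ℂ} (hz : z ∈ polydisc n) (L : V →L[ℂ] W)
    (f : Hardy V n) : Hardy.eval (amp n L f) z = L (Hardy.eval f z) := by
  rw [Hardy.eval, Hardy.eval, L.map_tsum (summable_eval hz f)]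
  simp

theorem eval_shift {z : Fin n → ℂ} (hz : z ∈ polydisc n) (k : Fin n → ℕ) (f : Hardy V n) :
    Hardy.eval (shift k f) z = (∏ i, z i ^ k i) • Hardy.eval f z := by
  have h : evalCLM (V := V) hz ∘L (shift k).toContinuousLinearMap =
      (∏ i, z i ^ k i) • evalCLM (V := V) hz := clm_ext fun l x => by
    simp [evalCLM_apply, shift_monomial, eval_monomial, pow_add, Finset.prod_mul_distrib,
      smul_smul]
  exact congrArg (fun T => T f) h

theorem isMultiplication_shift (i : Fin n) :
    IsMultiplication (fun z => z i • ContinuousLinearMap.id ℂ V)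
      (shift (Pi.single i 1) : Hardy V n →ₗᵢ[ℂ] Hardy V n).toContinuousLinearMap := by
  intro f z hz
  rw [LinearIsometry.coe_toContinuousLinearMap, eval_shift hz, Finset.prod_eq_single i]
  · simp
  · intro j _ hj
    simp [hj]
  · simp

end Eval

end Hardy

/-! ### Transfer functions -/

section Transfer

variable {E : Type u} [NormedAddCommGroup E] [InnerProductSpace ℂ E]
variable {n : ℕ} {K : Fin n → Type u} [∀ i, NormedAddCommGroup (K i)]
  [∀ i, InnerProductSpace ℂ (K i)]

theorem diagMul_apply (z : Fin n → ℂ) (y : PiLp 2 K) (i : Fin n) :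
    (diagMul K z y) i = z i • y i := rfl

theorem diagMul_eq_sum (z : Fin n → ℂ) :
    diagMul K z = ∑ i, z i • (Hardy.piSingle K i ∘L PiLp.proj 2 K i) := by
  refine ContinuousLinearMap.ext fun y => PiLp.ext fun i => ?_
  rw [sum_apply, WithLp.ofLp_sum, Finset.sum_apply, Finset.sum_eq_single i]
  · rw [diagMul_apply]
    change _ = z i • (Pi.single i (y i) : ∀ i, K i) i
    rw [Pi.single_eq_same]
  · intro j _ hj
    change z j • (Pi.single j (y j) : ∀ i, K i) i = 0
    rw [Pi.single_eq_of_ne hj.symm, smul_zero]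
  · simp

theorem norm_diagMul_lt {z : Fin n → ℂ} (hz : z ∈ polydisc n) : ‖diagMul K z‖ < 1 := by
  set r : NNReal := Finset.univ.sup fun i => ‖z i‖₊ with hr
  have hr1 : r < 1 := (Finset.sup_lt_iff (by simp)).2 fun i _ => hz i
  have hle : ∀ i, ‖z i‖ ≤ r := fun i =>
    Finset.le_sup (f := fun i => ‖z i‖₊) (Finset.mem_univ i)
  refine lt_of_le_of_lt (ContinuousLinearMap.opNorm_le_bound _ r.2 fun y => ?_) hr1
  refine (sq_le_sq₀ (norm_nonneg _) (mul_nonneg r.2 (norm_nonneg _))).1 ?_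
  rw [mul_pow, PiLp.norm_sq_eq_of_L2, PiLp.norm_sq_eq_of_L2, Finset.mul_sum]
  refine Finset.sum_le_sum fun i _ => ?_
  rw [diagMul_apply, norm_smul, mul_pow]
  exact mul_le_mul_of_nonneg_right (pow_le_pow_left₀ (norm_nonneg _) (hle i) 2) (sq_nonneg _)

variable (U : WithLp 2 (E × PiLp 2 K) ≃ₗᵢ[ℂ] WithLp 2 (E × PiLp 2 K))

theorem norm_sq_block (x : E) (y : PiLp 2 K) :
    ‖blockA U x + blockB U y‖ ^ 2 + ‖blockC U x + blockD U y‖ ^ 2 = ‖x‖ ^ 2 + ‖y‖ ^ 2 := by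
  have := inner_block U x x y y
  simp only [inner_self_eq_norm_sq_to_K] at this
  exact_mod_cast this

theorem norm_blockD_le : ‖blockD U‖ ≤ 1 := by
  refine ContinuousLinearMap.opNorm_le_bound _ zero_le_one fun y => ?_
  have := norm_sq_block U 0 y
  simp only [map_zero, zero_add, norm_zero] at this
  rw [one_mul]
  refine (sq_le_sq₀ (norm_nonneg _) (norm_nonneg _)).1 ?_
  nlinarith [sq_nonneg ‖blockB U y‖]

theorem norm_blockD_comp_diagMul_lt {z : Fin n → ℂ} (hz : z ∈ polydisc n) :
    ‖blockD U ∘L diagMul K z‖ < 1 := by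
  refine (ContinuousLinearMap.opNorm_comp_le _ _).trans_lt ?_
  exact (mul_le_of_le_one_left (norm_nonneg _) (norm_blockD_le U)).trans_lt (norm_diagMul_lt hz)

/-- The transfer function of `U`. -/
abbrev transfer (z : Fin n → ℂ) : E →L[ℂ] E :=
  transferFunction U.toContinuousLinearEquiv.toContinuousLinearMap z

variable [∀ i, CompleteSpace (K i)]

theorem isUnit_one_sub {z : Fin n → ℂ} (hz : z ∈ polydisc n) :
    IsUnit (1 - blockD U ∘L diagMul K z) :=
  isUnit_one_sub_of_norm_lt_one (norm_blockD_comp_diagMul_lt U hz)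

/-- The resolvent vector `u` solves `u = C x + D E(z) u`, so `U` maps `(x, E(z) u)` to `(Φ(z) x,
u)`; conclude from `‖E(z) u‖ ≤ ‖u‖`. -/
theorem norm_transfer_le {z : Fin n → ℂ} (hz : z ∈ polydisc n) : ‖transfer U z‖ ≤ 1 := by
  refine ContinuousLinearMap.opNorm_le_bound _ zero_le_one fun x => ?_
  set u := Ring.inverse (1 - blockD U ∘L diagMul K z) (blockC U x) with hu
  have h₁ : blockC U x + blockD U (diagMul K z u) = u := by
    have := congrArg (fun T : PiLp 2 K →L[ℂ] PiLp 2 K => T (blockC U x))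
      (Ring.mul_inverse_cancel _ (isUnit_one_sub U hz))
    have h : u - blockD U (diagMul K z u) = blockC U x := this
    rw [← h, sub_add_cancel]
  have h₂ : transfer U z x = blockA U x + blockB U (diagMul K z u) := rfl
  have h₃ := norm_sq_block U x (diagMul K z u)
  rw [h₁, ← h₂] at h₃
  have h₄ : ‖diagMul K z u‖ ≤ ‖u‖ :=
    (ContinuousLinearMap.le_of_opNorm_le _ (norm_diagMul_lt hz).le u).trans_eq (one_mul _)
  have h₅ := pow_le_pow_left₀ (norm_nonneg _) h₄ 2
  rw [one_mul]
  refine (sq_le_sq₀ (norm_nonneg _) (norm_nonneg _)).1 ?_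
  linarith

theorem differentiableOn_transfer : DifferentiableOn ℂ (transfer U) (polydisc n) := by
  have hd : Differentiable ℂ fun z : Fin n → ℂ => diagMul K z := by
    simp only [diagMul_eq_sum]
    fun_prop
  intro z hz
  have h₁ : DifferentiableAt ℂ (fun z : Fin n → ℂ => 1 - blockD U ∘L diagMul K z) z :=
    ((differentiableAt_const _).clm_comp (hd z)).const_sub _
  have h₂ : DifferentiableAt ℂ
      (fun z : Fin n → ℂ => Ring.inverse (1 - blockD U ∘L diagMul K z)) z :=
    h₁.inverse (isUnit_one_sub U hz)
  have h₄ : DifferentiableAt ℂ (fun z : Fin n → ℂ => blockA U + blockB U ∘L diagMul K z ∘L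
      Ring.inverse (1 - blockD U ∘L diagMul K z) ∘L blockC U) z :=
    ((differentiableAt_const _).clm_comp
      ((hd z).clm_comp (h₂.clm_comp (differentiableAt_const _)))).const_add _
  exact h₄.differentiableWithinAt

theorem isSchurAgler_transfer : IsSchurAgler (transfer U) :=
  ⟨differentiableOn_transfer U, ⟨1, fun _ hz => norm_transfer_le U hz⟩, K, inferInstance,
    inferInstance, inferInstance, U, fun _ _ => rfl⟩

namespace Hardy

variable [CompleteSpace E]

theorem eval_diagShift {z : Fin n → ℂ} (hz : z ∈ polydisc n) (g : Hardy (PiLp 2 K) n) :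
    Hardy.eval (diagShift K g) z = diagMul K z (Hardy.eval g z) := by
  refine PiLp.ext fun i => ?_
  rw [diagMul_apply]
  have h := eval_amp hz (PiLp.proj 2 K i : PiLp 2 K →L[ℂ] K i) (diagShift K g)
  rw [amp_proj_diagShift] at h
  have h' := isMultiplication_shift i (amp n (PiLp.proj 2 K i : PiLp 2 K →L[ℂ] K i) g) z hz
  rw [LinearIsometry.coe_toContinuousLinearMap, eval_amp hz] at h'
  exact h.symm.trans h'

theorem eval_stateTerm {z : Fin n → ℂ} (hz : z ∈ polydisc n) (m : ℕ) (x : E) :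
    Hardy.eval (stateTerm U m (monomial 0 x : Hardy E n)) z =
      ((blockD U ∘L diagMul K z) ^ m) (blockC U x) := by
  induction m with
  | zero =>
    rw [stateTerm_apply, pow_zero, pow_zero, amp_monomial]
    change Hardy.eval (monomial 0 (blockC U x)) z = blockC U x
    simp [eval_monomial]
  | succ m ih =>
    rw [stateTerm_succ, stateOp_apply, eval_amp hz, eval_diagShift hz, ih, pow_succ']
    rfl

theorem eval_multSum {z : Fin n → ℂ} (hz : z ∈ polydisc n) (p : ℕ) (x : E) :
    Hardy.eval (multSum U p (monomial 0 x)) z = blockA U x + blockB U (diagMul K z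
      ((∑ m ∈ Finset.range p, (blockD U ∘L diagMul K z) ^ m) (blockC U x))) := by
  rw [multSum_eq, ← evalCLM_apply hz, map_add, evalCLM_apply, evalCLM_apply, amp_monomial,
    eval_monomial, eval_amp hz, eval_diagShift hz, stateSum, ← evalCLM_apply hz, map_sum, sum_apply]
  simp only [evalCLM_apply, eval_stateTerm U hz]
  simp

variable [FiniteDimensional ℂ E] [∀ i, FiniteDimensional ℂ (K i)]

/-- Evaluation at `z` is continuous and turns the partial sums into those of the Neumann series of
`(1 - D E(z))⁻¹`. -/
theorem eval_innerVec {z : Fin n → ℂ} (hz : z ∈ polydisc n) (x : E) :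
    Hardy.eval (innerVec U x) z = transfer U z x := by
  have h₁ := ((evalCLM (V := E) hz).continuous.tendsto _).comp (tendsto_innerVec U x)
  refine tendsto_nhds_unique h₁ ?_
  have ht := norm_blockD_comp_diagMul_lt U hz
  have h₂ : HasSum (fun m => (blockD U ∘L diagMul K z) ^ m)
      (Ring.inverse (1 - blockD U ∘L diagMul K z)) := by
    rw [NormedRing.inverse_one_sub _ ht]
    exact (summable_geometric_of_norm_lt_one ht).hasSum
  have h₃ := h₂.tendsto_sum_nat
  have hcont : Continuous fun T : PiLp 2 K →L[ℂ] PiLp 2 K =>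
      blockA U x + blockB U (diagMul K z (T (blockC U x))) := by fun_prop
  refine ((hcont.tendsto _).comp h₃).congr fun p => ?_
  exact (eval_multSum U hz p x).symm

theorem isMultiplication_innerMult :
    IsMultiplication (transfer U) (innerMult U).toContinuousLinearMap := by
  intro f z hz
  have h : evalCLM (V := E) hz ∘L (innerMult U).toContinuousLinearMap =
      transfer U z ∘L evalCLM (V := E) hz := clm_ext fun k x => by
    simp [evalCLM_apply, innerMult_monomial, eval_shift hz, eval_innerVec U hz, eval_monomial]
  exact congrArg (fun T => T f) h

end Hardy

end Transfer

/-! ### Strong stability -/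

section Stability

variable {V : Type u} [NormedAddCommGroup V] [InnerProductSpace ℂ V]

theorem norm_pow_apply_le {T : V →L[ℂ] V} (hT : ‖T‖ ≤ 1) (m : ℕ) (x : V) :
    ‖(T ^ m) x‖ ≤ ‖x‖ := by
  induction m with
  | zero => exact le_rfl
  | succ m ih =>
    rw [pow_succ', mul_apply_eq_comp]
    exact ((T.le_of_opNorm_le hT _).trans_eq (one_mul _)).trans ih

/-- The vectors `x` with `T ^ m x → 0`. -/
def stableSubmodule (T : V →L[ℂ] V) : Submodule ℂ V where
  carrier := {x | Tendsto (fun m : ℕ => (T ^ m) x) atTop (𝓝 0)}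
  add_mem' hx hy := by simpa using Tendsto.add hx hy
  zero_mem' := by simp
  smul_mem' c x hx := by
    have h := Tendsto.const_smul hx c
    rw [smul_zero] at h
    exact h.congr fun m => (map_smul _ _ _).symm

theorem mem_stableSubmodule {T : V →L[ℂ] V} {x : V} :
    x ∈ stableSubmodule T ↔ Tendsto (fun m : ℕ => (T ^ m) x) atTop (𝓝 0) := Iff.rfl

theorem apply_mem_stableSubmodule {T : V →L[ℂ] V} {x : V} (hx : x ∈ stableSubmodule T) :
    T x ∈ stableSubmodule T := by
  have h := (mem_stableSubmodule.1 hx).comp (tendsto_add_atTop_nat 1)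
  refine h.congr fun m => ?_
  rw [Function.comp_apply, pow_succ, mul_apply_eq_comp]

/-- Later powers do not enlarge the error `(T ^ p) x - y`, so it is enough that some iterate of `x`
comes near the stable vectors. -/
theorem mem_stableSubmodule_of_approx {T : V →L[ℂ] V} (hT : ‖T‖ ≤ 1) {x : V}
    (h : ∀ ε > 0, ∃ p : ℕ, ∃ y ∈ stableSubmodule T, ‖(T ^ p) x - y‖ < ε) :
    x ∈ stableSubmodule T := by
  rw [mem_stableSubmodule, Metric.tendsto_atTop]
  intro ε hε
  obtain ⟨p, y, hy, hxy⟩ := h (ε / 2) (half_pos hε)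
  obtain ⟨N, hN⟩ := Metric.tendsto_atTop.1 (mem_stableSubmodule.1 hy) (ε / 2) (half_pos hε)
  refine ⟨N + p, fun m hm => ?_⟩
  have hN' := hN (m - p) (by omega)
  rw [dist_zero_right] at hN' ⊢
  have hsplit : (T ^ m) x = (T ^ (m - p)) ((T ^ p) x - y) + (T ^ (m - p)) y := by
    rw [← map_add, sub_add_cancel, ← mul_apply_eq_comp, ← pow_add, Nat.sub_add_cancel (by omega)]
  rw [hsplit]
  have h1 := norm_add_le ((T ^ (m - p)) ((T ^ p) x - y)) ((T ^ (m - p)) y)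
  have h2 := norm_pow_apply_le hT (m - p) ((T ^ p) x - y)
  linarith

theorem isClosed_stableSubmodule {T : V →L[ℂ] V} (hT : ‖T‖ ≤ 1) :
    IsClosed (stableSubmodule T : Set V) := by
  refine isClosed_of_closure_subset fun x hx => mem_stableSubmodule_of_approx hT fun ε hε => ?_
  obtain ⟨y, hy, hxy⟩ := Metric.mem_closure_iff.1 hx ε hε
  exact ⟨0, y, hy, by simpa [dist_eq_norm] using hxy⟩

theorem Hardy.mem_stableSubmodule {n : ℕ} {T : Hardy V n →L[ℂ] Hardy V n} (hT : ‖T‖ ≤ 1)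
    {f : Hardy V n} (h : ∀ k, monomial k (f k) ∈ stableSubmodule T) : f ∈ stableSubmodule T :=
  (isClosed_stableSubmodule hT).mem_of_tendsto (hasSum_monomial f)
    (Eventually.of_forall fun _ => Submodule.sum_mem _ fun k _ => h k)

theorem isPureIsometry_of_stable [CompleteSpace V] {T : V →ₗᵢ[ℂ] V}
    (h : ∀ x, x ∈ stableSubmodule T.toContinuousLinearMap.adjoint) :
    IsPureIsometry T.toContinuousLinearMap :=
  ⟨T.norm_map, T.norm_toContinuousLinearMap_le, h⟩

theorem norm_adjoint_le_one [CompleteSpace V] (T : V →ₗᵢ[ℂ] V) :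
    ‖T.toContinuousLinearMap.adjoint‖ ≤ 1 := by
  rw [LinearIsometryEquiv.norm_map]
  exact T.norm_toContinuousLinearMap_le

theorem adjoint_pow' [CompleteSpace V] (T : V →L[ℂ] V) (m : ℕ) :
    (T ^ m).adjoint = T.adjoint ^ m :=
  star_pow T m

theorem Hardy.adjoint_shift_pow_coeff [CompleteSpace V] {n : ℕ} (k : Fin n → ℕ) (m : ℕ) :
    ∀ (g : Hardy V n) (j : Fin n → ℕ),
      (((shift k : Hardy V n →ₗᵢ[ℂ] Hardy V n).toContinuousLinearMap.adjoint ^ m) g) j =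
        g (j + m • k) := by
  induction m with
  | zero => simp
  | succ m ih =>
    intro g j
    rw [pow_succ', mul_apply_eq_comp, adjoint_shift_coeff, ih, add_assoc, succ_nsmul']

/-- The adjoint is nilpotent on each monomial: its powers beyond `k i` kill `z ^ k`. -/
theorem Hardy.isPureIsometry_shift [CompleteSpace V] {n : ℕ} (i : Fin n) :
    IsPureIsometry (shift (Pi.single i 1) : Hardy V n →ₗᵢ[ℂ] Hardy V n).toContinuousLinearMap := by
  have hN := norm_adjoint_le_one (shift (Pi.single i 1) : Hardy V n →ₗᵢ[ℂ] Hardy V n)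
  refine isPureIsometry_of_stable fun f => Hardy.mem_stableSubmodule hN fun k => ?_
  rw [PolydiscDilation.mem_stableSubmodule]
  refine tendsto_const_nhds.congr' ?_
  filter_upwards [eventually_gt_atTop (k i)] with m hm
  refine lp.ext (funext fun j => ?_)
  rw [adjoint_shift_pow_coeff, monomial_coeff, if_neg]
  · rfl
  · intro hjk
    have := congrFun hjk i
    simp at this
    omega

/-- In finite dimension the spectrum consists of eigenvalues and the spectral radius is attained, so
it is below one; Gelfand's formula then bounds `‖A ^ m‖` by a geometric sequence. -/
theorem tendsto_pow_of_no_unimodular_eigenvalue [FiniteDimensional ℂ V] {A : V →L[ℂ] V}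
    (hA : ‖A‖ ≤ 1) (h : ∀ (c : ℂ) (x : V), ‖c‖ = 1 → A x = c • x → x = 0) :
    Tendsto (fun m : ℕ => ‖A ^ m‖) atTop (𝓝 0) := by
  have : CompleteSpace V := FiniteDimensional.complete ℂ V
  rcases subsingleton_or_nontrivial V with hV | hV
  · have : ∀ m : ℕ, ‖A ^ m‖ = 0 := fun m => by
      rw [norm_eq_zero]
      exact ContinuousLinearMap.ext fun x => Subsingleton.elim _ _
    simp [this]
  have hρ : spectralRadius ℂ A < 1 := by
    obtain ⟨c, hc, hcρ⟩ := spectrum.exists_nnnorm_eq_spectralRadius A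
    rw [← hcρ]
    have hle : ‖c‖ ≤ 1 := (spectrum.norm_le_norm_of_mem hc).trans hA
    have hne : ‖c‖ ≠ 1 := by
      intro h1
      rw [ContinuousLinearMap.spectrum_eq, ← Module.End.hasEigenvalue_iff_mem_spectrum] at hc
      obtain ⟨x, hx⟩ := hc.exists_hasEigenvector
      exact hx.2 (h c x h1 hx.apply_eq_smul)
    exact_mod_cast (lt_of_le_of_ne hle hne : ‖c‖ < 1)
  obtain ⟨r, hr, hr1⟩ := ENNReal.lt_iff_exists_nnreal_btwn.1 hρ
  have hr1' : (r : ℝ) < 1 := by exact_mod_cast hr1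
  have hev := (spectrum.pow_nnnorm_pow_one_div_tendsto_nhds_spectralRadius A).eventually_lt_const hr
  refine squeeze_zero' (Eventually.of_forall fun _ => norm_nonneg _) ?_
    (tendsto_pow_atTop_nhds_zero_of_lt_one r.2 hr1')
  filter_upwards [hev, eventually_gt_atTop 0] with m hm hm0
  have hm0' : (0 : ℝ) < m := by exact_mod_cast hm0
  have h₂ := ENNReal.rpow_le_rpow hm.le hm0'.le
  rw [← ENNReal.rpow_mul, one_div, inv_mul_cancel₀ hm0'.ne', ENNReal.rpow_one,
    ENNReal.rpow_natCast] at h₂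
  exact_mod_cast h₂

end Stability

/-! ### Purity of multiplication by the inner function -/

section Colligation

variable {E : Type u} [NormedAddCommGroup E] [InnerProductSpace ℂ E]
variable {n : ℕ} {K : Fin n → Type u} [∀ i, NormedAddCommGroup (K i)]
  [∀ i, InnerProductSpace ℂ (K i)] [CompleteSpace E] [∀ i, CompleteSpace (K i)]
  [FiniteDimensional ℂ E] [∀ i, FiniteDimensional ℂ (K i)]
variable (U : WithLp 2 (E × PiLp 2 K) ≃ₗᵢ[ℂ] WithLp 2 (E × PiLp 2 K))

namespace Hardy

theorem innerVec_coeff_zero (x : E) : (innerVec U x : Hardy E n) 0 = blockA U x := by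
  refine ext_inner_left ℂ fun w => ?_
  rw [← inner_monomial_left]
  refine tendsto_nhds_unique (tendsto_const_nhds.inner (tendsto_innerVec U x)) ?_
  refine tendsto_const_nhds.congr fun p => ?_
  rw [inner_monomial_left, multSum_eq, amp_monomial, lp.coeFn_add, Pi.add_apply, monomial_coeff,
    if_pos rfl, amp_coeff]
  have : (diagShift K (stateSum U p (monomial 0 x))) 0 = 0 :=
    PiLp.ext fun i => by rw [diagShift_coeff]; simp
  rw [this, map_zero, add_zero]

theorem innerVec_of_blockC_eq_zero {x : E} (hx : blockC U x = 0) :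
    innerVec U x = monomial 0 (blockA U x) := by
  refine tendsto_nhds_unique (tendsto_innerVec U x) (tendsto_const_nhds.congr fun p => ?_)
  have : ∀ m, stateTerm U m (monomial 0 x : Hardy E n) = 0 := fun m => by
    rw [stateTerm_apply, amp_monomial, hx, map_zero, map_zero]
  simp [multSum_eq, stateSum, this, amp_monomial]

theorem adjoint_innerMult_monomial_coeff (k j : Fin n → ℕ) (x y : E) :
    inner ℂ y (((innerMult U).toContinuousLinearMap.adjoint (monomial k x)) j) =
      inner ℂ ((shift j (innerVec U y) : Hardy E n) k) x := by
  rw [← inner_monomial_left, ContinuousLinearMap.adjoint_inner_right,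
    LinearIsometry.coe_toContinuousLinearMap, innerMult_monomial, inner_monomial_right]

/-- The adjoint sends `z ^ k x` to `z ^ k A⋆ x` plus monomials of strictly smaller index. By
induction those are stable, so modulo stable vectors the `p`-th power acts on `z ^ k x` as `A⋆ ^ p`,
which is eventually small. -/
theorem isPureIsometry_innerMult (hA : Tendsto (fun m : ℕ => ‖blockA U ^ m‖) atTop (𝓝 0)) :
    IsPureIsometry (innerMult U).toContinuousLinearMap := by
  set N := (innerMult U).toContinuousLinearMap.adjoint with hN
  have hN1 : ‖N‖ ≤ 1 := norm_adjoint_le_one _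
  have key : ∀ k x, (monomial k x : Hardy E n) ∈ stableSubmodule N := by
    intro k
    -- Induction is on the product order of multi-indices, not on total degree.
    induction k using WellFoundedLT.induction with
    | ind k ih =>
    have hstep : ∀ x, N (monomial k x) - monomial k ((blockA U).adjoint x) ∈
        stableSubmodule N := by
      intro x
      refine Hardy.mem_stableSubmodule hN1 fun j => ?_
      by_cases hj : j < k
      · exact ih j hj _
      -- At `j = k` the two terms cancel because `A = Φ(0)`; at any other `j` not below `k` both
      -- vanish.
      · have : (N (monomial k x) - monomial k ((blockA U).adjoint x) : Hardy E n) j = 0 := by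
          rw [lp.coeFn_sub, Pi.sub_apply, sub_eq_zero]
          refine ext_inner_left ℂ fun y => ?_
          rw [adjoint_innerMult_monomial_coeff, monomial_coeff, shift_coeff]
          by_cases hjk : j = k
          · subst hjk
            rw [if_pos le_rfl, if_pos rfl, tsub_self, innerVec_coeff_zero,
              ContinuousLinearMap.adjoint_inner_right]
          · rw [if_neg fun h => hj (lt_of_le_of_ne h hjk), if_neg hjk, inner_zero_left,
              inner_zero_right]
        rw [this, map_zero]
        exact Submodule.zero_mem _
    have hpow : ∀ (p : ℕ) x, (N ^ p) (monomial k x) - monomial k (((blockA U).adjoint ^ p) x) ∈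
        stableSubmodule N := by
      intro p
      induction p with
      | zero => intro x; simp
      | succ p ihp =>
        intro x
        have h₁ := apply_mem_stableSubmodule (ihp x)
        have h₂ := hstep (((blockA U).adjoint ^ p) x)
        have h₃ := Submodule.add_mem _ h₁ h₂
        rw [map_sub, sub_add_sub_cancel] at h₃
        rw [pow_succ', pow_succ', mul_apply_eq_comp, mul_apply_eq_comp]
        exact h₃
    intro x
    refine mem_stableSubmodule_of_approx hN1 fun ε hε => ?_
    have hlim : Tendsto (fun p : ℕ => ‖blockA U ^ p‖ * ‖x‖) atTop (𝓝 0) := by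
      simpa using hA.mul_const ‖x‖
    obtain ⟨p, hp⟩ := (hlim.eventually_lt_const hε).exists
    refine ⟨p, _, hpow p x, ?_⟩
    rw [sub_sub_cancel, norm_monomial, ← adjoint_pow']
    refine lt_of_le_of_lt (ContinuousLinearMap.le_opNorm _ _) ?_
    rwa [LinearIsometryEquiv.norm_map]
  exact isPureIsometry_of_stable fun f => Hardy.mem_stableSubmodule hN1 fun k => key k _

end Hardy

end Colligation

/-! ### The canonical dilation -/

section Dilation

variable {H : Type u} [NormedAddCommGroup H] [InnerProductSpace ℂ H]
variable {E : Type u} [NormedAddCommGroup E] [InnerProductSpace ℂ E]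
variable {n : ℕ} {K : Fin n → Type u} [∀ i, NormedAddCommGroup (K i)]
  [∀ i, InnerProductSpace ℂ (K i)]

namespace Hardy

/-- The canonical map `h ↦ ∑ k, z ^ k • D (T ^ k h)`. -/
def canonicalMap (T : Fin n → H →L[ℂ] H) (D : H →L[ℂ] E)
    (hsum : ∀ h, HasSum (fun k => ‖D (multiPow T k h)‖ ^ 2) (‖h‖ ^ 2)) : H →ₗᵢ[ℂ] Hardy E n where
  toFun h := ⟨fun k => D (multiPow T k h), memℓp_gen (by simpa using (hsum h).summable)⟩
  map_add' h h' := lp.ext (funext fun k => by simp; rfl)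
  map_smul' c h := lp.ext (funext fun k => by simp)
  norm_map' h := by
    rw [← sq_eq_sq₀ (norm_nonneg _) (norm_nonneg _)]
    exact (hasSum_norm_sq _).unique (hsum h)

variable {T : Fin n → H →L[ℂ] H} {D : H →L[ℂ] E}
  (hsum : ∀ h, HasSum (fun k => ‖D (multiPow T k h)‖ ^ 2) (‖h‖ ^ 2))

theorem canonicalMap_coeff (h : H) (k : Fin n → ℕ) :
    canonicalMap T D hsum h k = D (multiPow T k h) := rfl

theorem canonicalMap_multiPow [CompleteSpace E] (hT : ∀ i j, Commute (T i) (T j))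
    (k : Fin n → ℕ) (h : H) :
    canonicalMap T D hsum (multiPow T k h) =
      (shift k).toContinuousLinearMap.adjoint (canonicalMap T D hsum h) := by
  refine lp.ext (funext fun j => ?_)
  rw [adjoint_shift_coeff, canonicalMap_coeff, canonicalMap_coeff, multiPow_add hT]
  rfl

/-- The vector `(F i h)_i`. -/
def tupleVec (F : ∀ i, H →L[ℂ] K i) (h : H) : PiLp 2 K := WithLp.toLp 2 fun i => F i h

/-- The vector `(F i (T i h))_i`. -/
def shiftedTupleVec (T : Fin n → H →L[ℂ] H) (F : ∀ i, H →L[ℂ] K i) (h : H) : PiLp 2 K :=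
  WithLp.toLp 2 fun i => F i (T i h)

/-- The homogeneous part of degree `p` of `∑ k, z ^ k • (F i (T ^ k h))_i`. -/
def tupleHomog (T : Fin n → H →L[ℂ] H) (F : ∀ i, H →L[ℂ] K i) (p : ℕ) (h : H) :
    Hardy (PiLp 2 K) n :=
  ∑ k ∈ ofDegree n p, monomial k (tupleVec F (multiPow T k h))

variable {F : ∀ i, H →L[ℂ] K i}

theorem inner_tupleHomog (p : ℕ) (h : H) (g : Hardy (PiLp 2 K) n) :
    inner ℂ (tupleHomog T F p h) g =
      ∑ k ∈ ofDegree n p, inner ℂ (tupleVec F (multiPow T k h)) (g k) := by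
  simp only [tupleHomog, sum_inner, inner_monomial_left]

theorem norm_sq_tupleHomog (p : ℕ) (h : H) :
    ‖tupleHomog T F p h‖ ^ 2 = ∑ k ∈ ofDegree n p, ∑ i, ‖F i (multiPow T k h)‖ ^ 2 := by
  have hcoeff : ∀ k ∈ ofDegree n p,
      (tupleHomog T F p h) k = tupleVec F (multiPow T k h) := by
    intro k hk
    rw [tupleHomog, lp.coeFn_sum, Finset.sum_apply, Finset.sum_eq_single k]
    · rw [monomial_coeff, if_pos rfl]
    · intro j _ hj
      rw [monomial_coeff, if_neg hj.symm]
    · exact fun h => absurd hk h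
  have h₁ : inner ℂ (tupleHomog T F p h) (tupleHomog T F p h) =
      ((∑ k ∈ ofDegree n p, ‖tupleVec F (multiPow T k h)‖ ^ 2 : ℝ) : ℂ) := by
    rw [inner_tupleHomog]
    push_cast
    refine Finset.sum_congr rfl fun k hk => ?_
    rw [hcoeff k hk, inner_self_eq_norm_sq_to_K]
    rfl
  have h₂ : ‖tupleHomog T F p h‖ ^ 2 =
      ∑ k ∈ ofDegree n p, ‖tupleVec F (multiPow T k h)‖ ^ 2 := by
    rw [← inner_self_eq_norm_sq (𝕜 := ℂ), h₁]
    exact Complex.ofReal_re _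
  rw [h₂]
  exact Finset.sum_congr rfl fun k _ => PiLp.norm_sq_eq_of_L2 _ _

/-- The adjoint of `E(z)` lowers the degree by one and replaces `F i` by `F i ∘ T i`, which is what
the unitary `U` produces. -/
theorem inner_tupleHomog_diagShift (hT : ∀ i j, Commute (T i) (T j)) (p : ℕ) (h : H)
    (g : Hardy (PiLp 2 K) n) :
    inner ℂ (tupleHomog T F (p + 1) h) (diagShift K g) =
      ∑ k ∈ ofDegree n p, inner ℂ (shiftedTupleVec T F (multiPow T k h)) (g k) := by
  rw [inner_tupleHomog]
  simp only [PiLp.inner_apply]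
  rw [Finset.sum_comm, Finset.sum_comm (s := ofDegree n p)]
  refine Finset.sum_congr rfl fun i _ => ?_
  have h₁ : ∀ k : Fin n → ℕ, inner ℂ ((tupleVec F (multiPow T k h)) i) ((diagShift K g) k i) =
      if k i = 0 then 0 else
        inner ℂ (F i (multiPow T k h)) (g (k - Pi.single i 1) i) := by
    intro k
    rw [diagShift_coeff]
    split_ifs
    · rw [inner_zero_right]
    · rfl
  simp only [h₁]
  refine (sum_ofDegree_succ p i
    fun k => inner ℂ (F i (multiPow T k h)) (g (k - Pi.single i 1) i)).trans ?_
  refine Finset.sum_congr rfl fun k _ => ?_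
  rw [multiPow_add hT, multiPow_single, ← (commute_multiPow (fun j => hT i j) k).eq,
    add_tsub_cancel_right]
  rfl

theorem IsHomog.inner_eq_sum {V : Type u} [NormedAddCommGroup V] [InnerProductSpace ℂ V] {p : ℕ}
    {g : Hardy V n} (hg : IsHomog p g) (f : Hardy V n) :
    inner ℂ f g = ∑ k ∈ ofDegree n p, inner ℂ (f k) (g k) := by
  rw [lp.inner_eq_tsum]
  refine tsum_eq_sum fun k hk => ?_
  rw [hg k (by rwa [mem_ofDegree] at hk), inner_zero_right]

variable {U : WithLp 2 (E × PiLp 2 K) ≃ₗᵢ[ℂ] WithLp 2 (E × PiLp 2 K)} {R : H →L[ℂ] H}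
  (hU : ∀ h, U (WithLp.toLp 2 (D (R h), tupleVec F h)) =
    WithLp.toLp 2 (D h, shiftedTupleVec T F h))

include hU in
theorem inner_colligation (v : H) (x : E) (y : PiLp 2 K) :
    inner ℂ (D (R v)) x + inner ℂ (tupleVec F v) y =
      inner ℂ (D v) (blockA U x + blockB U y) +
        inner ℂ (shiftedTupleVec T F v) (blockC U x + blockD U y) := by
  have h := U.inner_map_map (WithLp.toLp 2 (D (R v), tupleVec F v)) (WithLp.toLp 2 (x, y))
  rw [hU, apply_toLp, WithLp.prod_inner_apply, WithLp.prod_inner_apply] at h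
  exact h.symm

include hU in
-- The relation `hU` at the vectors `multiPow T k h`, summed over the degree `p`. It is the
-- inductive step of `inner_canonicalMap_multSum`.
theorem inner_tupleHomog_eq (hT : ∀ i j, Commute (T i) (T j)) {p : ℕ} (h : H)
    {g : Hardy (PiLp 2 K) n} (hg : IsHomog p g) :
    inner ℂ (tupleHomog T F p h) g =
      inner ℂ (canonicalMap T D hsum h) (amp n (blockB U) g) +
        inner ℂ (tupleHomog T F (p + 1) h) (diagShift K (amp n (blockD U) g)) := by
  rw [inner_tupleHomog, (hg.amp _).inner_eq_sum, inner_tupleHomog_diagShift hT,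
    ← Finset.sum_add_distrib]
  refine Finset.sum_congr rfl fun k _ => ?_
  have := inner_colligation hU (multiPow T k h) 0 (g k)
  simp only [inner_zero_right, map_zero, zero_add] at this
  exact this

include hU in
theorem inner_canonicalMap_multSum (hT : ∀ i j, Commute (T i) (T j)) (h : H) (x : E) (p : ℕ) :
    inner ℂ (D (R h)) x = inner ℂ (canonicalMap T D hsum h) (multSum U p (monomial 0 x)) +
      inner ℂ (tupleHomog T F (p + 1) h) (diagShift K (stateTerm U p (monomial 0 x))) := by
  have hx : IsHomog 0 (monomial 0 x : Hardy E n) := by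
    simpa using isHomog_monomial (0 : Fin n → ℕ) x
  induction p with
  | zero =>
    have h₁ := inner_colligation hU h x 0
    have h₂ : multSum U 0 (monomial 0 x) = monomial 0 (blockA U x) := by
      simp [multSum_eq, stateSum, amp_monomial]
    have h₃ : stateTerm U 0 (monomial 0 x : Hardy E n) = monomial 0 (blockC U x) :=
      amp_monomial _ _ _
    have h₄ : ofDegree n 0 = {0} := Finset.piAntidiag_zero _
    rw [h₂, h₃, inner_monomial_right, inner_tupleHomog_diagShift hT, h₄, Finset.sum_singleton,
      canonicalMap_coeff, monomial_coeff, if_pos rfl, multiPow_zero]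
    simpa using h₁
  | succ p ih =>
    have hg := (hx.stateTerm U p).diagShift
    rw [zero_add] at hg
    rw [ih, inner_tupleHomog_eq hsum hU hT h hg, multSum, multSum, Finset.sum_range_succ _ (p + 1),
      inner_add_right, multTerm_succ, stateTerm_succ, stateOp_apply]
    ring

variable [CompleteSpace E] [∀ i, CompleteSpace (K i)]
  [FiniteDimensional ℂ E] [∀ i, FiniteDimensional ℂ (K i)]

include hU in
-- The remainder in `inner_canonicalMap_multSum` pairs a vector of norm at most `‖h‖` with one
-- tending to zero.
theorem inner_canonicalMap_innerVec (hT : ∀ i j, Commute (T i) (T j))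
    (hF : ∀ p h, ∑ k ∈ ofDegree n p, ∑ i, ‖F i (multiPow T k h)‖ ^ 2 ≤ ‖h‖ ^ 2) (h : H) (x : E) :
    inner ℂ (D (R h)) x = inner ℂ (canonicalMap T D hsum h) (innerVec U x) := by
  have hbound : ∀ p, ‖tupleHomog T F p h‖ ≤ ‖h‖ := fun p =>
    (sq_le_sq₀ (norm_nonneg _) (norm_nonneg _)).1 ((norm_sq_tupleHomog p h).trans_le (hF p h))
  have h₁ : Tendsto (fun p => inner ℂ (tupleHomog T F (p + 1) h)
      (diagShift K (stateTerm U p (monomial 0 x)))) atTop (𝓝 0) := by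
    have h₂ : Tendsto (fun p => ‖h‖ * ‖stateTerm U p (monomial 0 x : Hardy E n)‖) atTop
        (𝓝 0) := by
      simpa using (tendsto_stateTerm U x).norm.const_mul ‖h‖
    refine squeeze_zero_norm (fun p => ?_) h₂
    refine (norm_inner_le_norm _ _).trans ?_
    rw [LinearIsometry.norm_map]
    exact mul_le_mul_of_nonneg_right (hbound _) (norm_nonneg _)
  have h₃ := (tendsto_const_nhds (x := canonicalMap T D hsum h)).inner (𝕜 := ℂ)
    (tendsto_innerVec U x) |>.add h₁
  rw [add_zero] at h₃
  refine tendsto_nhds_unique (tendsto_const_nhds.congr fun p => ?_) h₃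
  exact inner_canonicalMap_multSum hsum hU hT h x p

include hU in
theorem canonicalMap_eq_adjoint_innerMult (hT : ∀ i j, Commute (T i) (T j))
    (hR : ∀ i, Commute R (T i))
    (hF : ∀ p h, ∑ k ∈ ofDegree n p, ∑ i, ‖F i (multiPow T k h)‖ ^ 2 ≤ ‖h‖ ^ 2) (h : H) :
    canonicalMap T D hsum (R h) =
      (innerMult U).toContinuousLinearMap.adjoint (canonicalMap T D hsum h) := by
  refine lp.ext (funext fun k => ext_inner_right ℂ fun x => ?_)
  have h₁ : multiPow T k (R h) = R (multiPow T k h) :=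
    (congrArg (fun S : H →L[ℂ] H => S h) (commute_multiPow hR k).eq).symm
  rw [← inner_monomial_right k x ((innerMult U).toContinuousLinearMap.adjoint _),
    ContinuousLinearMap.adjoint_inner_left, LinearIsometry.coe_toContinuousLinearMap,
    innerMult_monomial, canonicalMap_coeff, h₁, inner_canonicalMap_innerVec hsum hU hT hF,
    canonicalMap_multiPow hsum hT, ContinuousLinearMap.adjoint_inner_left]
  rfl

include hU hsum in
-- If `A x = c x` with `|c| = 1`, unitarity gives `C x = 0`, so `Φ x` is the constant `c x`. Then
-- `⟨D R^m h, x⟩ = c^m ⟨D h, x⟩` has constant modulus yet tends to zero, and `hD` gives `x = 0`.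
theorem tendsto_blockA_pow (hT : ∀ i j, Commute (T i) (T j))
    (hF : ∀ p h, ∑ k ∈ ofDegree n p, ∑ i, ‖F i (multiPow T k h)‖ ^ 2 ≤ ‖h‖ ^ 2)
    (hRp : ∀ h, Tendsto (fun m : ℕ => (R ^ m) h) atTop (𝓝 0))
    (hD : ∀ x : E, (∀ h, inner ℂ (D h) x = 0) → x = 0) :
    Tendsto (fun m : ℕ => ‖blockA U ^ m‖) atTop (𝓝 0) := by
  have hle : ∀ x, ‖blockA U x‖ ^ 2 + ‖blockC U x‖ ^ 2 = ‖x‖ ^ 2 := fun x => by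
    simpa using norm_sq_block U x 0
  refine tendsto_pow_of_no_unimodular_eigenvalue ?_ fun c x hc hx => ?_
  · refine ContinuousLinearMap.opNorm_le_bound _ zero_le_one fun x => ?_
    rw [one_mul]
    refine (sq_le_sq₀ (norm_nonneg _) (norm_nonneg _)).1 ?_
    linarith [hle x, sq_nonneg ‖blockC U x‖]
  · have hC : blockC U x = 0 := by
      have h₁ := hle x
      rw [hx, norm_smul, hc, one_mul] at h₁
      rw [← norm_eq_zero, ← sq_eq_zero_iff (a := ‖blockC U x‖)]
      linarith
    have hstep : ∀ h, inner ℂ (D (R h)) x = c * inner ℂ (D h) x := fun h => by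
      rw [inner_canonicalMap_innerVec hsum hU hT hF, innerVec_of_blockC_eq_zero U hC,
        inner_monomial_right, canonicalMap_coeff, multiPow_zero, hx, inner_smul_right]
      rfl
    have hpow : ∀ (m : ℕ) h, inner ℂ (D ((R ^ m) h)) x = c ^ m * inner ℂ (D h) x := by
      intro m
      induction m with
      | zero => simp
      | succ m ih =>
        intro h
        rw [pow_succ', mul_apply_eq_comp, hstep, ih, pow_succ', mul_assoc]
    refine hD x fun h => ?_
    have hlim : Tendsto (fun m : ℕ => ‖inner ℂ (D ((R ^ m) h)) x‖) atTop (𝓝 0) := by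
      have h₁ := (((D.continuous.tendsto _).comp (hRp h)).inner (𝕜 := ℂ)
        (tendsto_const_nhds (x := x))).norm
      simpa using h₁
    have hconst : ∀ m : ℕ, ‖inner ℂ (D ((R ^ m) h)) x‖ = ‖inner ℂ (D h) x‖ := fun m => by
      rw [hpow, norm_mul, norm_pow, hc, one_pow, one_mul]
    simp only [hconst] at hlim
    exact norm_eq_zero.1 (tendsto_nhds_unique tendsto_const_nhds hlim)

end Hardy

/-! ### A uniform bound on homogeneous parts -/

/-- Summing the energy identity over degree `p` turns `q p` into the part of `q (p + 1)` with `k i ≠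
0`, at the cost of `δ p (R h) - δ p h`; the part with `k i = 0` is `γ (p + 1)`. Telescoped, the `γ`
contribute at most `‖h‖ ^ 2 - ‖R h‖ ^ 2` and the `δ l (R h)` at most `‖R h‖ ^ 2`. -/
theorem sum_ofDegree_le {T : Fin n → H →L[ℂ] H} (hT : ∀ i j, Commute (T i) (T j))
    {R : H →L[ℂ] H} (hR : ∀ i, Commute R (T i)) {D : H →L[ℂ] E} {F : ∀ i, H →L[ℂ] K i}
    (hsum : ∀ h, HasSum (fun k => ‖D (multiPow T k h)‖ ^ 2) (‖h‖ ^ 2))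
    (henergy : ∀ h, ‖D h‖ ^ 2 + ∑ i, ‖F i (T i h)‖ ^ 2 = ‖D (R h)‖ ^ 2 + ∑ i, ‖F i h‖ ^ 2)
    (h : H) {g : Fin n → ℝ}
    (hg : ∀ i, HasSum (fun k => if k i = 0 then ‖F i (multiPow T k h)‖ ^ 2 else 0) (g i))
    (hgsum : ∑ i, g i = ‖h‖ ^ 2 - ‖R h‖ ^ 2) (p : ℕ) :
    ∑ k ∈ ofDegree n p, ∑ i, ‖F i (multiPow T k h)‖ ^ 2 ≤ ‖h‖ ^ 2 := by
  set q : ℕ → ℝ := fun p => ∑ k ∈ ofDegree n p, ∑ i, ‖F i (multiPow T k h)‖ ^ 2 with hq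
  set γ : ℕ → ℝ := fun p => ∑ i, ∑ k ∈ ofDegree n p,
    (if k i = 0 then ‖F i (multiPow T k h)‖ ^ 2 else 0) with hγ
  set δ : ℕ → H → ℝ := fun p h => ∑ k ∈ ofDegree n p, ‖D (multiPow T k h)‖ ^ 2 with hδ
  have hstep : ∀ p, q (p + 1) = q p + γ (p + 1) + δ p (R h) - δ p h := by
    intro p
    have h₁ : q (p + 1) = γ (p + 1) + ∑ i, ∑ k ∈ ofDegree n (p + 1),
        (if k i = 0 then 0 else ‖F i (multiPow T k h)‖ ^ 2) := by
      simp only [hq, hγ]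
      rw [Finset.sum_comm, ← Finset.sum_add_distrib]
      refine Finset.sum_congr rfl fun i _ => ?_
      rw [← Finset.sum_add_distrib]
      refine Finset.sum_congr rfl fun k _ => ?_
      split_ifs <;> simp
    have h₂ : ∑ i, ∑ k ∈ ofDegree n (p + 1),
        (if k i = 0 then 0 else ‖F i (multiPow T k h)‖ ^ 2) =
        ∑ k ∈ ofDegree n p, ∑ i, ‖F i (T i (multiPow T k h))‖ ^ 2 := by
      rw [Finset.sum_comm (s := ofDegree n p)]
      refine Finset.sum_congr rfl fun i _ => ?_
      rw [sum_ofDegree_succ p i fun k => ‖F i (multiPow T k h)‖ ^ 2]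
      refine Finset.sum_congr rfl fun k _ => ?_
      rw [multiPow_add hT, multiPow_single, ← (commute_multiPow (fun j => hT i j) k).eq]
      rfl
    have h₃ : δ p h + ∑ k ∈ ofDegree n p, ∑ i, ‖F i (T i (multiPow T k h))‖ ^ 2 =
        δ p (R h) + q p := by
      simp only [hδ, hq]
      rw [← Finset.sum_add_distrib, ← Finset.sum_add_distrib]
      refine Finset.sum_congr rfl fun k _ => ?_
      have h₄ : multiPow T k (R h) = R (multiPow T k h) :=
        (congrArg (fun S : H →L[ℂ] H => S h) (commute_multiPow hR k).eq).symm
      rw [henergy, h₄]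
    linarith
  have hq0 : q 0 = γ 0 := by
    have h₄ : ofDegree n 0 = {0} := Finset.piAntidiag_zero _
    simp [hq, hγ, h₄]
  have htotal : ∀ p, q p + ∑ l ∈ Finset.range p, δ l h =
      ∑ l ∈ Finset.range (p + 1), γ l + ∑ l ∈ Finset.range p, δ l (R h) := by
    intro p
    induction p with
    | zero => simp [hq0]
    | succ p ih =>
      rw [Finset.sum_range_succ γ (p + 1), Finset.sum_range_succ (fun l => δ l h) p,
        Finset.sum_range_succ (fun l => δ l (R h)) p, hstep]
      linarith
  have hγle : ∑ l ∈ Finset.range (p + 1), γ l ≤ ‖h‖ ^ 2 - ‖R h‖ ^ 2 := by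
    rw [← hgsum]
    simp only [hγ]
    rw [Finset.sum_comm]
    refine Finset.sum_le_sum fun i _ => sum_range_ofDegree_le (fun k => ?_) (hg i) _
    split_ifs
    · exact sq_nonneg _
    · exact le_rfl
  have hδle := sum_range_ofDegree_le (fun _ => sq_nonneg _) (hsum (R h)) p
  have hδ0 : 0 ≤ ∑ l ∈ Finset.range p, δ l h :=
    Finset.sum_nonneg fun _ _ => Finset.sum_nonneg fun _ _ => sq_nonneg _
  have := htotal p
  simp only [hδ] at this hδ0
  linarith

end Dilation

/-! ### The tuples of the class `P_n` -/

section Main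

variable {H : Type u} [NormedAddCommGroup H] [InnerProductSpace ℂ H] [CompleteSpace H] {n : ℕ}

theorem commute_adjoint {A B : H →L[ℂ] H} (h : Commute A B) : Commute A.adjoint B.adjoint :=
  h.star_star

theorem hasSum_defect {X : Fin (n + 1) → H →L[ℂ] H} (hpure : ∀ i, IsPureContraction (X i))
    (hS : (szegoInv (dropLast X)).IsPositive) (h : H) :
    HasSum (fun k => ‖sqrtTo (szegoInv (dropLast X))
      (multiPow (fun i : Fin n => (X i.castSucc).adjoint) k h)‖ ^ 2) (‖h‖ ^ 2) := by
  have := hasSum_szegoMap (dropLast X) (fun i => (hpure _).2) 1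
    (fun h => by rw [← szegoInv_eq, ← norm_sqrtTo_sq hS]; exact sq_nonneg _) h
  rw [reApplyInnerSelf_one] at this
  simpa only [← szegoInv_eq, ← norm_sqrtTo_sq hS] using! this

/-- This is `hasSum_szegoMap` for `Q = G i` and the tuple with `i`-th entry zero, whose powers
vanish unless `k i = 0`. -/
theorem hasSum_partialSzego {X : Fin (n + 1) → H →L[ℂ] H}
    (hpure : ∀ i, IsPureContraction (X i)) {G : Fin n → H →L[ℂ] H} (i : Fin n)
    (hG : (partialSzego X G i).IsPositive) (h : H) :
    HasSum (fun k : Fin n → ℕ => if k i = 0 then ‖sqrtTo (partialSzego X G i)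
      (multiPow (fun i : Fin n => (X i.castSucc).adjoint) k h)‖ ^ 2 else 0)
      ((G i).reApplyInnerSelf h) := by
  have hupd : (fun j => (Function.update (dropLast X) i 0 j).adjoint) =
      Function.update (fun i : Fin n => (X i.castSucc).adjoint) i 0 := by
    funext j
    by_cases hj : j = i
    · subst hj; simp
    · simp [hj, dropLast]
  have := hasSum_szegoMap (Function.update (dropLast X) i 0) (fun j h => ?_) (G i)
    (fun h => by rw [← partialSzego_eq, ← norm_sqrtTo_sq hG]; exact sq_nonneg _) h
  · rw [hupd] at this
    simp only [← partialSzego_eq, ← norm_sqrtTo_sq hG, multiPow_update_zero] at this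
    convert this using 2 with k
    split_ifs
    · rfl
    · simp
  · by_cases hj : j = i
    · subst hj
      refine tendsto_const_nhds.congr' ?_
      filter_upwards [eventually_gt_atTop 0] with m hm
      simp [hm.ne']
    · simpa [hj] using! (hpure _).2 h

theorem sum_reApplyInnerSelf {X : Fin (n + 1) → H →L[ℂ] H} {G : Fin n → H →L[ℂ] H}
    (hG : 1 - X (Fin.last n) * (X (Fin.last n)).adjoint = ∑ i, G i) (h : H) :
    ∑ i, (G i).reApplyInnerSelf h = ‖h‖ ^ 2 - ‖(X (Fin.last n)).adjoint h‖ ^ 2 := by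
  rw [← reApplyInnerSelf_sum, ← hG, ← reApplyInnerSelf_one h, ← reApplyInnerSelf_one
    ((X (Fin.last n)).adjoint h), ← reApplyInnerSelf_conjMap, conjMap_apply, mul_one,
    eq_sub_iff_add_eq, ← reApplyInnerSelf_add, sub_add_cancel]

theorem exists_colligation {E : Type u} [NormedAddCommGroup E] [InnerProductSpace ℂ E]
    {K : Fin n → Type u} [∀ i, NormedAddCommGroup (K i)] [∀ i, InnerProductSpace ℂ (K i)]
    [FiniteDimensional ℂ E] [∀ i, FiniteDimensional ℂ (K i)] (T : Fin n → H →L[ℂ] H)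
    (R : H →L[ℂ] H) (D : H →L[ℂ] E) (F : ∀ i, H →L[ℂ] K i)
    (henergy : ∀ h, ‖D h‖ ^ 2 + ∑ i, ‖F i (T i h)‖ ^ 2 = ‖D (R h)‖ ^ 2 + ∑ i, ‖F i h‖ ^ 2) :
    ∃ U : WithLp 2 (E × PiLp 2 K) ≃ₗᵢ[ℂ] WithLp 2 (E × PiLp 2 K),
      ∀ h, U (WithLp.toLp 2 (D (R h), Hardy.tupleVec F h)) =
        WithLp.toLp 2 (D h, Hardy.shiftedTupleVec T F h) := by
  let a : H →ₗ[ℂ] WithLp 2 (E × PiLp 2 K) :=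
    { toFun := fun h => WithLp.toLp 2 (D (R h), Hardy.tupleVec F h)
      map_add' := fun x y => by
        simp only [Hardy.tupleVec, map_add]
        rfl
      map_smul' := fun c x => by
        simp only [Hardy.tupleVec, map_smul]
        rfl }
  let b : H →ₗ[ℂ] WithLp 2 (E × PiLp 2 K) :=
    { toFun := fun h => WithLp.toLp 2 (D h, Hardy.shiftedTupleVec T F h)
      map_add' := fun x y => by
        simp only [Hardy.shiftedTupleVec, map_add]
        rfl
      map_smul' := fun c x => by
        simp only [Hardy.shiftedTupleVec, map_smul]
        rfl }
  refine exists_linearIsometryEquiv_of_norm_eq a b fun h => ?_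
  rw [← sq_eq_sq₀ (norm_nonneg _) (norm_nonneg _), WithLp.prod_norm_sq_eq_of_L2,
    WithLp.prod_norm_sq_eq_of_L2]
  have h₁ : ‖(b h).snd‖ ^ 2 = ∑ i, ‖F i (T i h)‖ ^ 2 := PiLp.norm_sq_eq_of_L2 _ _
  have h₂ : ‖(a h).snd‖ ^ 2 = ∑ i, ‖F i h‖ ^ 2 := PiLp.norm_sq_eq_of_L2 _ _
  rw [h₁, h₂]
  exact (henergy h).symm

end Main

end PolydiscDilation

end

/-! ### Assembly of the dilation -/

theorem mainTheorem12 {H : Type*} [NormedAddCommGroup H] [InnerProductSpace ℂ H] [CompleteSpace H]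
    (n : ℕ) (X : Fin (n + 1) → H →L[ℂ] H)
    (hpure : ∀ i, PolydiscDilation.IsPureContraction (X i))
    (hP : PolydiscDilation.MemP X) (hfin : PolydiscDilation.IsFiniteRank X) :
    ∃ Φ : (Fin n → ℂ) →
        PolydiscDilation.defectSpace X →L[ℂ] PolydiscDilation.defectSpace X,
      PolydiscDilation.IsSchurAgler Φ ∧
      ∃ V : Fin (n + 1) → PolydiscDilation.Hardy (PolydiscDilation.defectSpace X) n →L[ℂ]
          PolydiscDilation.Hardy (PolydiscDilation.defectSpace X) n,
        (∀ i : Fin n, PolydiscDilation.IsMultiplication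
          (fun z => z i • ContinuousLinearMap.id ℂ (PolydiscDilation.defectSpace X))
          (V i.castSucc)) ∧
        PolydiscDilation.IsMultiplication Φ (V (Fin.last n)) ∧
        (∀ i j, Commute (V i) (V j)) ∧
        (∀ i, PolydiscDilation.IsPureIsometry (V i)) ∧
        PolydiscDilation.DilatesTo X V := by
  open PolydiscDilation in
  obtain ⟨⟨-, hcomm⟩, ⟨-, hS⟩, -⟩ := hP
  obtain ⟨hfinD, G, hG, hfinF⟩ := hfin
  have hcD : CompleteSpace (defectSpace X) := FiniteDimensional.complete ℂ _
  have hcF : ∀ i, CompleteSpace (sqrtRange (partialSzego X G i)) := fun i =>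
    FiniteDimensional.complete ℂ _
  let T : Fin n → H →L[ℂ] H := fun i => (X i.castSucc).adjoint
  let R : H →L[ℂ] H := (X (Fin.last n)).adjoint
  let D : H →L[ℂ] defectSpace X := sqrtTo (szegoInv (dropLast X))
  let F : ∀ i, H →L[ℂ] sqrtRange (partialSzego X G i) := fun i => sqrtTo (partialSzego X G i)
  have hT : ∀ i j, Commute (T i) (T j) := fun i j => commute_adjoint (hcomm _ _)
  have hR : ∀ i, Commute R (T i) := fun i => commute_adjoint (hcomm _ _)
  have hsum : ∀ h, HasSum (fun k => ‖D (multiPow T k h)‖ ^ 2) (‖h‖ ^ 2) := hasSum_defect hpure hS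
  have henergy := norm_energy hcomm hG hS
  have hF : ∀ p h, ∑ k ∈ ofDegree n p, ∑ i, ‖F i (multiPow T k h)‖ ^ 2 ≤ ‖h‖ ^ 2 := fun p h =>
    sum_ofDegree_le hT hR hsum henergy h (fun i => hasSum_partialSzego hpure i (hG.2.2 i) h)
      (sum_reApplyInnerSelf hG.2.1 h) p
  obtain ⟨U, hU⟩ := exists_colligation T R D F henergy
  -- Purity of the last entry `X_n` enters only here; the sums above use the purity of the other
  -- entries.
  have hA := Hardy.tendsto_blockA_pow hsum hU hT hF (hpure _).2 eq_zero_of_inner_sqrtTo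
  let V : Fin (n + 1) → Hardy (defectSpace X) n →L[ℂ] Hardy (defectSpace X) n :=
    Fin.snoc (fun i => (Hardy.shift (Pi.single i 1)).toContinuousLinearMap)
      (Hardy.innerMult U).toContinuousLinearMap
  have hV : ∀ i : Fin n, V i.castSucc = (Hardy.shift (Pi.single i 1)).toContinuousLinearMap :=
    fun i => Fin.snoc_castSucc (α := fun _ => _) _ _ _
  have hVl : V (Fin.last n) = (Hardy.innerMult U).toContinuousLinearMap :=
    Fin.snoc_last (α := fun _ => _) _ _
  have hVcomm : ∀ i : Fin n, Commute (V (Fin.last n)) (V i.castSucc) := fun i => by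
    rw [hV, hVl]
    exact ContinuousLinearMap.ext fun f => Hardy.innerMult_shift U _ f
  refine ⟨transfer U, isSchurAgler_transfer U, V, fun i => ?_, ?_, fun i j => ?_, fun i => ?_,
    Hardy.canonicalMap T D hsum, fun i h => ?_⟩
  · rw [hV]
    exact Hardy.isMultiplication_shift i
  · rw [hVl]
    exact Hardy.isMultiplication_innerMult U
  · refine Fin.lastCases ?_ (fun i => ?_) i <;> refine Fin.lastCases ?_ (fun j => ?_) j
    · exact Commute.refl _
    · exact hVcomm j
    · exact (hVcomm i).symm
    · rw [hV, hV]
      refine ContinuousLinearMap.ext fun f => ?_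
      change Hardy.shift _ (Hardy.shift _ f) = Hardy.shift _ (Hardy.shift _ f)
      rw [Hardy.shift_shift, Hardy.shift_shift, add_comm]
  · refine Fin.lastCases ?_ (fun i => ?_) i
    · rw [hVl]
      exact Hardy.isPureIsometry_innerMult U hA
    · rw [hV]
      exact Hardy.isPureIsometry_shift i
  · refine Fin.lastCases ?_ (fun i => ?_) i
    · rw [hVl]
      exact Hardy.canonicalMap_eq_adjoint_innerMult hsum hU hT hR hF h
    · rw [hV, ← Hardy.canonicalMap_multiPow hsum hT, multiPow_single]
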